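/- **Setting.** Let $\pi=p_0p_1\cdots p_n$ and $\sigma=q_0q_1\cdots q_m$ ($n,m\ge 1$) be polygonal curves in $\mathbb R^d$ with distinct consecutive vertices, parameterized by arc length on $[0,|\pi|]$ and $[0,|\sigma|]$. Their free space diagram is $R=[0,|\pi|]\times[0,|\sigma|]$, with elevation $e(x,y)=\|\pi(x)-\sigma(y)\|$. Let $x_i$ and $y_j$ be the arc lengths at which $p_i$ and $q_j$ are reached; they split $R$ into the grid cells $C_{i,j}=[x_i,x_{i+1}]\times[y_j,y_{j+1}]$. **CDTW.** A monotone morphing is a non-self-intersecting curve $\mathsf m\subseteq R$ from $(0,0)$ to $(|\pi|,|\sigma|)$ along which both coordinates are nondecreasing. Its cost is $$\mathrm{cost}(\mathsf m)=\int_0^{|\pi|}\min_{y:(x,y)\in\mathsf m}e(x,y)\,dx+\int_0^{|\sigma|}\min_{x:(x,y)\in\mathsf m}e(x,y)\,dy ,$$ and $d_{TW}(\pi,\sigma)$ is the infimum of $\mathrm{cost}(\mathsf m)$ over all monotone morphings. **Sweep distance.** The portal of a grid edge is its point of minimum elevation, except that the portals of the grid edges incident to the corner $(0,0)$ or $(|\pi|,|\sigma|)$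 of $R$ are moved to that corner. The VE graph has the portals as vertices (coinciding portals being identified) and, in each cell, directed edges from the portals of the bottom and left edges to those of the top and right edges. A segment $ab\subseteq R$ has price $(|b_x-a_x|+|b_y-a_y|)\int_0^1e((1-t)a+tb)\,dt$. The sweep procedure computes a shortest path (with respect to price) from $(0,0)$ to $(|\pi|,|\sigma|)$ in the VE graph; if the path is monotone in both coordinates, its price is the output; otherwise the two curves are refined by inserting vertices along their edges (for example the middle points of the portions traversed backwards) and the procedure is repeated on the refined curves. A value $d_{SW}(\pi,\sigma)$ is any output of this procedure, for any choice of inserted vertices and of shortest paths. **Lower bound.** The flattened elevation of a cell is $\min_{C_{i,j}}e$, and that of a grid edge is the minimum of the flattened elevations of the (one or two) cells adjacent to it. Let $lb_{SD}(\pi,\sigma)$ be the length of a shortest path from $(0,0)$ to $(|\pi|,|\sigma|)$ in the grid graph whose horizontal edges are directed to the right and vertical edges upwards, where the weight of an edge is its length times its flattened elevation. **Splitting.** Splitting a curve inserts a vertex in the middle of each of its edges; $\pi^i$ denotes the result of $i$ iterations of splitting of $\pi$. **Lemma.** For all such $\pi$ and $\sigma$, $lb_{SD}(\pi,\sigma)\le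 d_{SW}(\pi,\sigma)$ for every value $d_{SW}(\pi,\sigma)$ output by the sweep procedure. Moreover, $$\lim_{i\to\infty}lb_{SD}(\pi^i,\sigma^i)=d_{TW}(\pi,\sigma).$$ -/

import Mathlib

open Filter Topology

noncomputable section

namespace CurveSweep

/-- A directed polygonal curve in `ℝ^d` with `n ≥ 1` edges and vertices `vtx 0, …, vtx n`,
consecutive vertices being distinct. Values `vtx k` with `k > n` are never used. -/
structure PolyCurve (d : ℕ) where
  n : ℕ
  n_pos : 0 < n
  vtx : ℕ → EuclideanSpace ℝ (Fin d)
  vtx_ne : ∀ i < n, vtx i ≠ vtx (i + 1)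

namespace PolyCurve

variable {d : ℕ}

/-- Length of the `i`-th edge. -/
def edgeLen (P : PolyCurve d) (i : ℕ) : ℝ := dist (P.vtx i) (P.vtx (i + 1))

/-- Arc length from the start of the curve to its `i`-th vertex. -/
def brk (P : PolyCurve d) (i : ℕ) : ℝ := ∑ k ∈ Finset.range i, P.edgeLen k

/-- Length of the curve. -/
def len (P : PolyCurve d) : ℝ := P.brk P.n

/-- Uniform (arc length) parameterization on `[0, len]`: to reach arc length `x`, the `k`-th edge
is traversed up to the fraction `(x - brk k) / edgeLen k`, clamped to `[0, 1]`. -/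
def param (P : PolyCurve d) (x : ℝ) : EuclideanSpace ℝ (Fin d) :=
  P.vtx 0 + ∑ k ∈ Finset.range P.n,
    max 0 (min 1 ((x - P.brk k) / P.edgeLen k)) • (P.vtx (k + 1) - P.vtx k)

/-- Splitting: a new vertex in the middle of every edge. Even indices give the old vertices
(`k / 2` and `(k + 1) / 2` agree), odd indices the midpoints of the edges. -/
def split (P : PolyCurve d) : PolyCurve d where
  n := 2 * P.n
  n_pos := by have := P.n_pos; omega
  vtx k := midpoint ℝ (P.vtx (k / 2)) (P.vtx ((k + 1) / 2))
  vtx_ne := by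
    intro k hk
    rcases Nat.even_or_odd' k with ⟨c, rfl | rfl⟩
    · have h1 : 2 * c / 2 = c := by omega
      have h2 : (2 * c + 1) / 2 = c := by omega
      have h3 : (2 * c + 1 + 1) / 2 = c + 1 := by omega
      rw [h1, h2, h3, midpoint_self]
      intro h
      exact P.vtx_ne c (by omega) ((left_eq_midpoint_iff ℝ).1 h)
    · have h1 : (2 * c + 1) / 2 = c := by omega
      have h2 : (2 * c + 1 + 1) / 2 = c + 1 := by omega
      have h3 : (2 * c + 1 + 1 + 1) / 2 = c + 1 := by omega
      rw [h1, h2, h3, midpoint_self]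
      intro h
      exact P.vtx_ne c (by omega) ((midpoint_eq_right_iff ℝ).1 h)

/-- `P'` is a refinement of `P`: the vertices of `P` occur in `P'` in order (at the indices `φ i`),
the first and last ones being the first and last vertices of `P'`, and the vertices of `P'`
in between lie in order along the corresponding directed edge of `P`. -/
def IsRefinement (P P' : PolyCurve d) : Prop :=
  ∃ (φ : ℕ → ℕ) (t : ℕ → ℕ → ℝ), φ 0 = 0 ∧ φ P.n = P'.n ∧
    ∀ i < P.n, φ i < φ (i + 1) ∧ t i (φ i) = 0 ∧ t i (φ (i + 1)) = 1 ∧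
      MonotoneOn (t i) (Set.Icc (φ i) (φ (i + 1))) ∧
      ∀ k ∈ Set.Icc (φ i) (φ (i + 1)),
        P'.vtx k = AffineMap.lineMap (P.vtx i) (P.vtx (i + 1)) (t i k)

end PolyCurve

section Paths

variable {V : Type*}

/-- `l` is the vertex sequence of a directed path from `s` to `t` in the graph with edge
relation `E`. -/
def IsPath (E : V → V → Prop) (s t : V) (l : List V) : Prop :=
  l.IsChain E ∧ l.head? = some s ∧ l.getLast? = some t

/-- Total weight of the consecutive pairs of a vertex sequence. -/
def pathWeight (w : V → V → ℝ) : List V → ℝ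
  | [] => 0
  | [_] => 0
  | a :: b :: l => w a b + pathWeight w (b :: l)

/-- `l` is a shortest path from `s` to `t`. -/
def IsShortestPath (E : V → V → Prop) (w : V → V → ℝ) (s t : V) (l : List V) : Prop :=
  IsPath E s t l ∧ ∀ l', IsPath E s t l' → pathWeight w l ≤ pathWeight w l'

end Paths

variable {d : ℕ}

/-- The elevation function on the free space diagram `[0, P.len] × [0, Q.len]`. -/
def elev (P Q : PolyCurve d) (z : ℝ × ℝ) : ℝ := dist (P.param z.1) (Q.param z.2)

/-! ### Continuous dynamic time warping -/

/-- `m` is an `x/y`-monotone morphing: a non-self-intersecting curve in the free space diagram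
from `(0, 0)` to `(P.len, Q.len)` along which both coordinates are nondecreasing. -/
def IsMonotoneMorphing (P Q : PolyCurve d) (m : Set (ℝ × ℝ)) : Prop :=
  ∃ γ : ℝ → ℝ × ℝ, ContinuousOn γ (Set.Icc 0 1) ∧ Set.InjOn γ (Set.Icc 0 1) ∧
    MonotoneOn γ (Set.Icc 0 1) ∧ γ 0 = (0, 0) ∧ γ 1 = (P.len, Q.len) ∧ m = γ '' Set.Icc 0 1

/-- Warping cost of a morphing: the integral over `x` of the shortest leash attached to `P(x)`
plus the integral over `y` of the shortest leash attached to `Q(y)`. -/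
def warpCost (P Q : PolyCurve d) (m : Set (ℝ × ℝ)) : ℝ :=
  (∫ x in (0 : ℝ)..P.len, sInf {r | ∃ y, (x, y) ∈ m ∧ r = elev P Q (x, y)}) +
    ∫ y in (0 : ℝ)..Q.len, sInf {r | ∃ x, (x, y) ∈ m ∧ r = elev P Q (x, y)}

/-- The continuous dynamic time warping (CDTW) distance. -/
def cdtw (P Q : PolyCurve d) : ℝ :=
  sInf {c | ∃ m, IsMonotoneMorphing P Q m ∧ c = warpCost P Q m}

/-! ### The sweep distance -/

/-- `z` is the portal on the horizontal grid edge `[x_i, x_{i+1}] × {y_j}`: its point of minimum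
elevation, except that the portals on the grid edges at the corners `(0, 0)` and
`(P.len, Q.len)` are moved to these corners. -/
def IsHPortal (P Q : PolyCurve d) (i j : ℕ) (z : ℝ × ℝ) : Prop :=
  if i = 0 ∧ j = 0 then z = (0, 0)
  else if i + 1 = P.n ∧ j = Q.n then z = (P.len, Q.len)
  else z.1 ∈ Set.Icc (P.brk i) (P.brk (i + 1)) ∧ z.2 = Q.brk j ∧
    ∀ x ∈ Set.Icc (P.brk i) (P.brk (i + 1)), elev P Q z ≤ elev P Q (x, Q.brk j)

/-- `z` is the portal on the vertical grid edge `{x_i} × [y_j, y_{j+1}]`. -/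
def IsVPortal (P Q : PolyCurve d) (i j : ℕ) (z : ℝ × ℝ) : Prop :=
  if i = 0 ∧ j = 0 then z = (0, 0)
  else if i = P.n ∧ j + 1 = Q.n then z = (P.len, Q.len)
  else z.1 = P.brk i ∧ z.2 ∈ Set.Icc (Q.brk j) (Q.brk (j + 1)) ∧
    ∀ y ∈ Set.Icc (Q.brk j) (Q.brk (j + 1)), elev P Q z ≤ elev P Q (P.brk i, y)

/-- Edges of the VE graph (its vertices are the portals, given by their locations): in every cell
`(i, j)`, from each incoming portal (bottom and left edge) to each outgoing portal (top and right
edge) different from it. -/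
def veEdge (P Q : PolyCurve d) (a b : ℝ × ℝ) : Prop :=
  a ≠ b ∧ ∃ i < P.n, ∃ j < Q.n,
    (IsHPortal P Q i j a ∨ IsVPortal P Q i j a) ∧
    (IsHPortal P Q i (j + 1) b ∨ IsVPortal P Q (i + 1) j b)

/-- Price of the segment `ab` of the free space diagram: under the linear motion along `ab`, the
integral of the leash length over the part of `P` traversed (of length `|b.1 - a.1|`) plus its
integral over the part of `Q` traversed (of length `|b.2 - a.2|`). -/
def segPrice (P Q : PolyCurve d) (a b : ℝ × ℝ) : ℝ :=
  |b.1 - a.1| * (∫ t in (0 : ℝ)..1, elev P Q (AffineMap.lineMap a b t)) +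
    |b.2 - a.2| * (∫ t in (0 : ℝ)..1, elev P Q (AffineMap.lineMap a b t))

/-- `l` is a shortest path, for the above prices, from the bottom left to the top right corner in
the VE graph. -/
def IsShortestVEPath (P Q : PolyCurve d) (l : List (ℝ × ℝ)) : Prop :=
  IsShortestPath (veEdge P Q) (segPrice P Q) (0, 0) (P.len, Q.len) l

/-- `IsSweepDistance P Q w`: the sweep procedure run on `P` and `Q` may output `w`. A shortest
path in the VE graph is computed; if it is `x/y`-monotone, its price is the output; otherwise the
curves are refined by inserting vertices and the procedure is repeated on the refined curves.
No restriction is put on which vertices are inserted or on how ties between shortest paths are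
broken; inserting the middle points of the portions traversed backwards is one of the
possibilities. -/
inductive IsSweepDistance : PolyCurve d → PolyCurve d → ℝ → Prop
  | output (P Q : PolyCurve d) (l : List (ℝ × ℝ)) (hl : IsShortestVEPath P Q l)
      (hmono : l.IsChain (· ≤ ·)) : IsSweepDistance P Q (pathWeight (segPrice P Q) l)
  | refine (P Q P' Q' : PolyCurve d) (l : List (ℝ × ℝ)) (w : ℝ) (hl : IsShortestVEPath P Q l)
      (hmono : ¬ l.IsChain (· ≤ ·)) (hP : P.IsRefinement P') (hQ : Q.IsRefinement Q')
      (hw : IsSweepDistance P' Q' w) : IsSweepDistance P Q w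

/-! ### The lower bound -/

/-- The `(i, j)` cell of the free space diagram. -/
def cell (P Q : PolyCurve d) (i j : ℕ) : Set (ℝ × ℝ) :=
  Set.Icc (P.brk i) (P.brk (i + 1)) ×ˢ Set.Icc (Q.brk j) (Q.brk (j + 1))

/-- The flattened elevation of a cell: the minimum elevation in the cell. -/
def flat (P Q : PolyCurve d) (i j : ℕ) : ℝ := sInf (elev P Q '' cell P Q i j)

/-- Flattened elevation of the horizontal grid edge from `(x_i, y_j)` to `(x_{i+1}, y_j)`: the
minimum over the (one or two) cells adjacent to it. -/
def hFlat (P Q : PolyCurve d) (i j : ℕ) : ℝ :=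
  sInf {c | ∃ j' < Q.n, (j' = j ∨ j' + 1 = j) ∧ c = flat P Q i j'}

/-- Flattened elevation of the vertical grid edge from `(x_i, y_j)` to `(x_i, y_{j+1})`. -/
def vFlat (P Q : PolyCurve d) (i j : ℕ) : ℝ :=
  sInf {c | ∃ i' < P.n, (i' = i ∨ i' + 1 = i) ∧ c = flat P Q i' j}

/-- The directed grid graph on `{0, …, P.n} × {0, …, Q.n}`: edges go one step to the right or one
step up. -/
def gridEdge (P Q : PolyCurve d) (a b : ℕ × ℕ) : Prop :=
  b.1 ≤ P.n ∧ b.2 ≤ Q.n ∧ (b = (a.1 + 1, a.2) ∨ b = (a.1, a.2 + 1))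

/-- Weight of a grid edge: its length times its flattened elevation. -/
def gridWeight (P Q : PolyCurve d) (a b : ℕ × ℕ) : ℝ :=
  if a.2 = b.2 then P.edgeLen a.1 * hFlat P Q a.1 a.2
  else Q.edgeLen a.2 * vFlat P Q a.1 a.2

/-- Length of a shortest path from bottom left to top right in the weighted grid graph. -/
def lowerBound (P Q : PolyCurve d) : ℝ :=
  sInf (pathWeight (gridWeight P Q) '' {l | IsPath (gridEdge P Q) (0, 0) (P.n, Q.n) l})

end CurveSweep

end

namespace CurveSweep
open PolyCurve

variable {d : ℕ}

/-! ### Arc length, parameterization and piecewise linear interpolation -/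

namespace PolyCurve

/-! Everything rests on one potential, the bilinear interpolation of the grid distances from `(0,
0)`. It is at most `0` at the bottom left corner and equals `lowerBound` at the top right. A grid
edge weighs at most its length times the flattened elevation of either adjacent cell, so on all four
sides of a cell the distances grow at a rate at most `flat` of that cell. Interpolation carries this
bound inside: under a nondecreasing displacement within a cell, the potential grows by at most
`flat` times the L¹ length (`potential_sub_le`).

Hence `lowerBound` is at most the cost of any monotone route that pays at least `flat` per unit of
L¹ length in each cell. Three kinds of route are used. Monotone VE paths bound the output of a sweep
that stops. Grid paths of a refinement show that refining cannot decrease `lowerBound`, which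
handles the other sweeps. Monotone morphings give `lowerBound ≤ cdtw`; for these, the two integrals
of the warping cost are merged into a single integral of the elevation along the curve parameterized
by the sum of its coordinates (`warpCost_image_monoPath`).

Conversely, a grid path is itself a morphing. The elevation is 1-Lipschitz in each arc length, so
within a cell it exceeds `flat` by at most the sum `δ` of the two edge lengths, and `cdtw ≤
lowerBound + δ * (P.len + Q.len)`. Splitting leaves `cdtw` unchanged and halves all edges, so the
error tends to `0`. -/

lemma edgeLen_pos (P : PolyCurve d) {i : ℕ} (hi : i < P.n) : 0 < P.edgeLen i :=
  dist_pos.2 (P.vtx_ne i hi)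

lemma brk_zero (P : PolyCurve d) : P.brk 0 = 0 := by simp [brk]

lemma brk_succ (P : PolyCurve d) (i : ℕ) : P.brk (i + 1) = P.brk i + P.edgeLen i :=
  Finset.sum_range_succ _ _

lemma brk_mono (P : PolyCurve d) : Monotone P.brk :=
  monotone_nat_of_le_succ fun i => by
    rw [brk_succ]; exact le_add_of_nonneg_right dist_nonneg

lemma brk_nonneg (P : PolyCurve d) (i : ℕ) : 0 ≤ P.brk i :=
  P.brk_zero ▸ P.brk_mono (Nat.zero_le i)

lemma len_nonneg (P : PolyCurve d) : 0 ≤ P.len := P.brk_nonneg _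

/-- Clamped piecewise linear interpolation of the values `g i` at the breakpoints of `P`. -/
noncomputable def interp {E : Type*} [AddCommGroup E] [Module ℝ E] (P : PolyCurve d) (g : ℕ → E)
    (x : ℝ) : E :=
  g 0 + ∑ k ∈ Finset.range P.n,
    max 0 (min 1 ((x - P.brk k) / P.edgeLen k)) • (g (k + 1) - g k)

lemma param_eq_interp (P : PolyCurve d) : P.param = P.interp P.vtx := rfl

lemma continuous_interp {E : Type*} [AddCommGroup E] [Module ℝ E] [TopologicalSpace E]
    [ContinuousAdd E] [ContinuousSMul ℝ E] (P : PolyCurve d) (g : ℕ → E) :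
    Continuous (P.interp g) := by
  unfold interp
  fun_prop

section interp

variable {E : Type*} [AddCommGroup E] [Module ℝ E] (P : PolyCurve d) (g : ℕ → E)

/-- The clamped coefficients are `1` before edge `i`, where the sum telescopes, and `0` after it. -/
lemma interp_eq {i : ℕ} (hi : i < P.n) {x : ℝ}
    (hx : x ∈ Set.Icc (P.brk i) (P.brk (i + 1))) :
    P.interp g x = g i + ((x - P.brk i) / P.edgeLen i) • (g (i + 1) - g i) := by
  have hlow : ∀ k ∈ Finset.range i,
      max 0 (min 1 ((x - P.brk k) / P.edgeLen k)) • (g (k + 1) - g k) = g (k + 1) - g k := by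
    intro k hk
    have hki := Finset.mem_range.1 hk
    have h0 := P.edgeLen_pos (hki.trans hi)
    have h1 : P.brk k + P.edgeLen k ≤ x := by
      rw [← brk_succ]; exact (P.brk_mono hki).trans hx.1
    have h2 : 1 ≤ (x - P.brk k) / P.edgeLen k := by rw [le_div_iff₀ h0]; linarith
    rw [min_eq_left h2, max_eq_right zero_le_one, one_smul]
  have hhigh : ∀ k ∈ Finset.Ico (i + 1) P.n,
      max 0 (min 1 ((x - P.brk k) / P.edgeLen k)) • (g (k + 1) - g k) = 0 := by
    intro k hk
    obtain ⟨h1, h2⟩ := Finset.mem_Ico.1 hk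
    have h3 : (x - P.brk k) / P.edgeLen k ≤ 0 :=
      div_nonpos_of_nonpos_of_nonneg (by linarith [hx.2, P.brk_mono h1]) (P.edgeLen_pos h2).le
    rw [max_eq_left ((min_le_right _ _).trans h3), zero_smul]
  have h0 := P.edgeLen_pos hi
  have hi2 := hx.2
  rw [brk_succ] at hi2
  have hmid : max 0 (min 1 ((x - P.brk i) / P.edgeLen i)) = (x - P.brk i) / P.edgeLen i := by
    rw [min_eq_right, max_eq_right]
    · exact div_nonneg (by linarith [hx.1]) h0.le
    · rw [div_le_one h0]; linarith
  rw [interp, ← Finset.sum_range_add_sum_Ico _ (Nat.succ_le_of_lt hi), Finset.sum_range_succ,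
    Finset.sum_congr rfl hlow, Finset.sum_eq_zero hhigh, Finset.sum_range_sub, hmid]
  abel

lemma interp_of_nonpos {x : ℝ} (hx : x ≤ 0) : P.interp g x = g 0 := by
  rw [interp, Finset.sum_eq_zero, add_zero]
  intro k hk
  have h3 : (x - P.brk k) / P.edgeLen k ≤ 0 :=
    div_nonpos_of_nonpos_of_nonneg (by linarith [P.brk_nonneg k]) dist_nonneg
  rw [max_eq_left ((min_le_right _ _).trans h3), zero_smul]

lemma interp_of_len_le {x : ℝ} (hx : P.len ≤ x) : P.interp g x = g P.n := by
  rw [interp, Finset.sum_congr rfl, Finset.sum_range_sub (f := g)]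
  · abel
  intro k hk
  have hk := Finset.mem_range.1 hk
  have h0 := P.edgeLen_pos hk
  have h1 : P.brk k + P.edgeLen k ≤ x := by
    rw [← brk_succ]; exact (P.brk_mono hk).trans hx
  have h2 : 1 ≤ (x - P.brk k) / P.edgeLen k := by rw [le_div_iff₀ h0]; linarith
  rw [min_eq_left h2, max_eq_right zero_le_one, one_smul]

end interp

lemma dist_param_le (P : PolyCurve d) {i : ℕ} (hi : i < P.n) {x y : ℝ}
    (hx : x ∈ Set.Icc (P.brk i) (P.brk (i + 1))) (hy : y ∈ Set.Icc (P.brk i) (P.brk (i + 1))) :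
    dist (P.param x) (P.param y) ≤ P.edgeLen i := by
  have h0 := P.edgeLen_pos hi
  rw [param_eq_interp, interp_eq _ _ hi hx, interp_eq _ _ hi hy, dist_add_left, dist_eq_norm,
    ← sub_smul, norm_smul, ← sub_div, ← dist_eq_norm, dist_comm (P.vtx (i + 1))]
  change _ * P.edgeLen i ≤ _
  rw [Real.norm_eq_abs, abs_div, abs_of_pos h0, div_mul_cancel₀ _ h0.ne']
  have := P.brk_succ i
  rw [abs_le]
  constructor <;> linarith [hx.1, hx.2, hy.1, hy.2]

/-- Every point of `[0, len]` lies in an edge interval that also contains the points of `[0, len]`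
to its right that are close enough. -/
lemma exists_edge_right (P : PolyCurve d) {x : ℝ} (h0 : 0 ≤ x) (h1 : x ≤ P.len) :
    ∃ i < P.n, x ∈ Set.Icc (P.brk i) (P.brk (i + 1)) ∧
      ∃ δ > 0, ∀ x', x ≤ x' → x' ≤ P.len → x' < x + δ →
        x' ∈ Set.Icc (P.brk i) (P.brk (i + 1)) := by
  rcases h1.eq_or_lt with rfl | h1
  · have hn : P.n - 1 + 1 = P.n := Nat.sub_add_cancel P.n_pos
    have h2 : P.brk (P.n - 1) ≤ P.len := P.brk_mono (Nat.sub_le _ _)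
    refine ⟨P.n - 1, by omega, ⟨h2, by rw [hn]; rfl⟩, 1, one_pos, fun x' h h' _ => ?_⟩
    exact ⟨h2.trans h, by rw [hn]; exact h'⟩
  · have key : ∀ k, x < P.brk k → ∃ i < k, P.brk i ≤ x ∧ x < P.brk (i + 1) := by
      intro k
      induction k with
      | zero => intro h; rw [brk_zero] at h; linarith
      | succ k ih =>
        intro h
        by_cases hk : P.brk k ≤ x
        · exact ⟨k, k.lt_succ_self, hk, h⟩
        · obtain ⟨i, hi, h⟩ := ih (not_le.1 hk)
          exact ⟨i, hi.trans k.lt_succ_self, h⟩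
    obtain ⟨i, hi, h2, h3⟩ := key P.n h1
    refine ⟨i, hi, ⟨h2, h3.le⟩, P.brk (i + 1) - x, by linarith, fun x' h _ h' => ?_⟩
    exact ⟨h2.trans h, by linarith⟩

end PolyCurve

/-! ### The elevation function -/

lemma elev_nonneg (P Q : PolyCurve d) (z : ℝ × ℝ) : 0 ≤ elev P Q z := dist_nonneg

lemma continuous_elev (P Q : PolyCurve d) : Continuous (elev P Q) :=
  ((P.continuous_interp P.vtx).comp continuous_fst).dist
    ((Q.continuous_interp Q.vtx).comp continuous_snd)

/-! ### Flattened elevations -/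

lemma flat_nonneg (P Q : PolyCurve d) (i j : ℕ) : 0 ≤ flat P Q i j :=
  Real.sInf_nonneg (by rintro _ ⟨z, -, rfl⟩; exact elev_nonneg P Q z)

lemma flat_le_elev (P Q : PolyCurve d) {i j : ℕ} {z : ℝ × ℝ} (hz : z ∈ cell P Q i j) :
    flat P Q i j ≤ elev P Q z :=
  csInf_le ⟨0, by rintro _ ⟨z, -, rfl⟩; exact elev_nonneg P Q z⟩ ⟨z, hz, rfl⟩

lemma le_flat (P Q : PolyCurve d) {i j : ℕ} {c : ℝ} (h : ∀ z ∈ cell P Q i j, c ≤ elev P Q z) :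
    c ≤ flat P Q i j := by
  refine le_csInf ⟨_, (P.brk i, Q.brk j), ⟨⟨le_rfl, P.brk_mono i.le_succ⟩,
    ⟨le_rfl, Q.brk_mono j.le_succ⟩⟩, rfl⟩ ?_
  rintro _ ⟨z, hz, rfl⟩
  exact h z hz

lemma hFlat_le (P Q : PolyCurve d) {i j j' : ℕ} (hj : j' < Q.n) (h : j' = j ∨ j' + 1 = j) :
    hFlat P Q i j ≤ flat P Q i j' :=
  csInf_le ⟨0, by rintro _ ⟨k, -, -, rfl⟩; exact flat_nonneg P Q i k⟩ ⟨j', hj, h, rfl⟩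

lemma vFlat_le (P Q : PolyCurve d) {i j i' : ℕ} (hi : i' < P.n) (h : i' = i ∨ i' + 1 = i) :
    vFlat P Q i j ≤ flat P Q i' j :=
  csInf_le ⟨0, by rintro _ ⟨k, -, -, rfl⟩; exact flat_nonneg P Q k j⟩ ⟨i', hi, h, rfl⟩

/-- The bound on `j` makes the set of adjacent cells nonempty, so that the infimum is not the
default value `0`; on the top line only the cell below remains. -/
lemma le_hFlat (P Q : PolyCurve d) {i j : ℕ} {c : ℝ} (hj : j ≤ Q.n)
    (h : ∀ j' < Q.n, (j' = j ∨ j' + 1 = j) → c ≤ flat P Q i j') : c ≤ hFlat P Q i j := by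
  refine le_csInf ?_ (by rintro _ ⟨k, hk, hkj, rfl⟩; exact h k hk hkj)
  rcases hj.lt_or_eq with hj | hj
  · exact ⟨_, j, hj, Or.inl rfl, rfl⟩
  · have := Q.n_pos
    exact ⟨_, j - 1, by omega, Or.inr (by omega), rfl⟩

lemma le_vFlat (P Q : PolyCurve d) {i j : ℕ} {c : ℝ} (hi : i ≤ P.n)
    (h : ∀ i' < P.n, (i' = i ∨ i' + 1 = i) → c ≤ flat P Q i' j) : c ≤ vFlat P Q i j := by
  refine le_csInf ?_ (by rintro _ ⟨k, hk, hkj, rfl⟩; exact h k hk hkj)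
  rcases hi.lt_or_eq with hi | hi
  · exact ⟨_, i, hi, Or.inl rfl, rfl⟩
  · have := P.n_pos
    exact ⟨_, i - 1, by omega, Or.inr (by omega), rfl⟩

lemma gridWeight_right (P Q : PolyCurve d) (i j : ℕ) :
    gridWeight P Q (i, j) (i + 1, j) = P.edgeLen i * hFlat P Q i j := by simp [gridWeight]

lemma gridWeight_up (P Q : PolyCurve d) (i j : ℕ) :
    gridWeight P Q (i, j) (i, j + 1) = Q.edgeLen j * vFlat P Q i j := by simp [gridWeight]

lemma gridWeight_nonneg (P Q : PolyCurve d) (a b : ℕ × ℕ) : 0 ≤ gridWeight P Q a b := by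
  unfold gridWeight
  split_ifs
  · exact mul_nonneg dist_nonneg
      (Real.sInf_nonneg (by rintro _ ⟨k, -, -, rfl⟩; exact flat_nonneg P Q _ k))
  · exact mul_nonneg dist_nonneg
      (Real.sInf_nonneg (by rintro _ ⟨k, -, -, rfl⟩; exact flat_nonneg P Q k _))

/-! ### Paths -/

section Paths

variable {V : Type*} {E : V → V → Prop} {w : V → V → ℝ}

lemma pathWeight_nonneg (hw : ∀ a b, 0 ≤ w a b) : ∀ l, 0 ≤ pathWeight w l
  | [] => le_rfl
  | [_] => le_rfl
  | a :: b :: l => add_nonneg (hw a b) (pathWeight_nonneg hw (b :: l))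

lemma pathWeight_concat (b c : V) : ∀ l : List V, l.getLast? = some b →
    pathWeight w (l ++ [c]) = pathWeight w l + w b c
  | [], h => by simp at h
  | [a], h => by
    obtain rfl : a = b := by simpa using h
    simp [pathWeight]
  | a :: a' :: l, h => by
    have := pathWeight_concat b c (a' :: l) (by simpa using h)
    simp only [List.cons_append, pathWeight] at this ⊢
    rw [this, add_assoc]

lemma IsPath.concat {s b c : V} {l : List V} (h : IsPath E s b l) (hc : E b c) :
    IsPath E s c (l ++ [c]) := by
  obtain ⟨h1, h2, h3⟩ := h
  refine ⟨?_, by simp [h2], by simp⟩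
  rw [List.isChain_append]
  refine ⟨h1, by simp, fun x hx y hy => ?_⟩
  rw [h3] at hx
  obtain rfl : b = x := by simpa using hx
  obtain rfl : c = y := by simpa using hy
  exact hc

/-- A potential that increases by at most the weight along every edge bounds path weights. -/
lemma potential_sub_le_pathWeight {φ : V → ℝ} (hφ : ∀ a b, E a b → φ b - φ a ≤ w a b) {t : V} :
    ∀ (l : List V) (s : V), IsPath E s t l → φ t - φ s ≤ pathWeight w l
  | [], s, h => by simp [IsPath] at h
  | [a], s, h => by
    obtain ⟨-, h1, h2⟩ := h
    obtain rfl : a = s := by simpa using h1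
    obtain rfl : a = t := by simpa using h2
    simp [pathWeight]
  | a :: b :: l, s, h => by
    obtain ⟨h0, h1, h2⟩ := h
    obtain rfl : a = s := by simpa using h1
    rw [List.isChain_cons_cons] at h0
    have := potential_sub_le_pathWeight hφ (l := b :: l) b ⟨h0.2, rfl, by simpa using h2⟩
    have := hφ a b h0.1
    simp only [pathWeight]
    linarith

end Paths

/-! ### Distances in the grid graph and their bilinear interpolation -/

/-- Distance from `(0, 0)` in the weighted grid graph. -/
noncomputable def gridDist (P Q : PolyCurve d) (i j : ℕ) : ℝ :=
  sInf (pathWeight (gridWeight P Q) '' {l | IsPath (gridEdge P Q) (0, 0) (i, j) l})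

lemma gridDist_le (P Q : PolyCurve d) {i j : ℕ} {l : List (ℕ × ℕ)}
    (h : IsPath (gridEdge P Q) (0, 0) (i, j) l) :
    gridDist P Q i j ≤ pathWeight (gridWeight P Q) l :=
  csInf_le ⟨0, by rintro _ ⟨l, -, rfl⟩; exact pathWeight_nonneg (gridWeight_nonneg P Q) l⟩
    ⟨l, h, rfl⟩

lemma exists_gridPath (P Q : PolyCurve d) {i j : ℕ} (hi : i ≤ P.n) (hj : j ≤ Q.n) :
    ∃ l, IsPath (gridEdge P Q) (0, 0) (i, j) l := by
  induction j with
  | zero =>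
    induction i with
    | zero => exact ⟨[(0, 0)], by simp, rfl, rfl⟩
    | succ i ih =>
      obtain ⟨l, hl⟩ := ih (by omega)
      exact ⟨_, hl.concat ⟨hi, hj, Or.inl rfl⟩⟩
  | succ j ih =>
    obtain ⟨l, hl⟩ := ih (by omega)
    exact ⟨_, hl.concat ⟨hi, hj, Or.inr rfl⟩⟩

lemma gridDist_le_add (P Q : PolyCurve d) {i j i' j' : ℕ} (hi : i ≤ P.n) (hj : j ≤ Q.n)
    (h : gridEdge P Q (i, j) (i', j')) :
    gridDist P Q i' j' ≤ gridDist P Q i j + gridWeight P Q (i, j) (i', j') := by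
  rw [← sub_le_iff_le_add]
  obtain ⟨l, hl⟩ := exists_gridPath P Q hi hj
  refine le_csInf ⟨_, l, hl, rfl⟩ ?_
  rintro _ ⟨l, hl, rfl⟩
  rw [sub_le_iff_le_add, ← pathWeight_concat _ _ _ hl.2.2]
  exact gridDist_le P Q (hl.concat h)

/-- The cell `j'` may be on either side of the edge, because the edge weight uses the minimum of
both. -/
lemma gridDist_succ_left_le (P Q : PolyCurve d) {i j j' : ℕ} (hi : i < P.n) (hj : j ≤ Q.n)
    (hj' : j' < Q.n) (h : j' = j ∨ j' + 1 = j) :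
    gridDist P Q (i + 1) j - gridDist P Q i j ≤ P.edgeLen i * flat P Q i j' := by
  have := gridDist_le_add P Q hi.le hj (i' := i + 1) (j' := j) ⟨hi, hj, Or.inl rfl⟩
  rw [gridWeight_right] at this
  have := mul_le_mul_of_nonneg_left (hFlat_le P Q (i := i) hj' h) (P.edgeLen_pos hi).le
  linarith

lemma gridDist_succ_right_le (P Q : PolyCurve d) {i j i' : ℕ} (hi : i ≤ P.n) (hj : j < Q.n)
    (hi' : i' < P.n) (h : i' = i ∨ i' + 1 = i) :
    gridDist P Q i (j + 1) - gridDist P Q i j ≤ Q.edgeLen j * flat P Q i' j := by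
  have := gridDist_le_add P Q hi hj.le (i' := i) (j' := j + 1) ⟨hi, hj, Or.inr rfl⟩
  rw [gridWeight_up] at this
  have := mul_le_mul_of_nonneg_left (vFlat_le P Q (j := j) hi' h) (Q.edgeLen_pos hj).le
  linarith

/-- Bilinear interpolation of the grid distances. -/
noncomputable def potential (P Q : PolyCurve d) (z : ℝ × ℝ) : ℝ :=
  P.interp (fun i => Q.interp (fun j => gridDist P Q i j) z.2) z.1

lemma continuous_potential (P Q : PolyCurve d) : Continuous (potential P Q) := by
  unfold potential interp
  fun_prop

lemma potential_origin_nonpos (P Q : PolyCurve d) : potential P Q (0, 0) ≤ 0 := by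
  rw [potential, interp_of_nonpos _ _ le_rfl, interp_of_nonpos _ _ le_rfl]
  exact gridDist_le P Q (l := [(0, 0)]) ⟨by simp, rfl, rfl⟩

lemma potential_end (P Q : PolyCurve d) : potential P Q (P.len, Q.len) = lowerBound P Q := by
  rw [potential, interp_of_len_le _ _ le_rfl, interp_of_len_le _ _ le_rfl]
  rfl

/-- The displacement is made in two legs: `α` to `α'` at height `β`, then `β` to `β'` at abscissa
`α'`. On each leg the slope is a convex combination of the slopes on two opposite sides of the cell.
-/
lemma bilinear_sub_le {α α' β β' p q c A B C D : ℝ} (h0 : 0 ≤ β) (h1 : β ≤ 1) (h2 : 0 ≤ α')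
    (h3 : α' ≤ 1) (hα : α ≤ α') (hβ : β ≤ β') (hAB : B - A ≤ p * c) (hCD : D - C ≤ p * c)
    (hAC : C - A ≤ q * c) (hBD : D - B ≤ q * c) :
    (A + β' * (C - A) + α' * (B + β' * (D - B) - (A + β' * (C - A)))) -
      (A + β * (C - A) + α * (B + β * (D - B) - (A + β * (C - A)))) ≤
      c * (p * (α' - α) + q * (β' - β)) := by
  have hx : (1 - β) * (B - A) + β * (D - C) ≤ p * c := by
    nlinarith [mul_le_mul_of_nonneg_left hAB (sub_nonneg.2 h1), mul_le_mul_of_nonneg_left hCD h0]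
  have hy : (1 - α') * (C - A) + α' * (D - B) ≤ q * c := by
    nlinarith [mul_le_mul_of_nonneg_left hAC (sub_nonneg.2 h3), mul_le_mul_of_nonneg_left hBD h2]
  have hx' := mul_le_mul_of_nonneg_left hx (sub_nonneg.2 hα)
  have hy' := mul_le_mul_of_nonneg_left hy (sub_nonneg.2 hβ)
  linear_combination hx' + hy'

/-- Inside a cell the potential grows at most at the rate given by the flattened elevation. -/
lemma potential_sub_le (P Q : PolyCurve d) {i j : ℕ} (hi : i < P.n) (hj : j < Q.n)
    {a b : ℝ × ℝ} (ha : a ∈ cell P Q i j) (hb : b ∈ cell P Q i j) (hab : a ≤ b) :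
    potential P Q b - potential P Q a ≤ flat P Q i j * ((b.1 - a.1) + (b.2 - a.2)) := by
  have hp := P.edgeLen_pos hi
  have hq := Q.edgeLen_pos hj
  have h1 := P.brk_succ i
  have h2 := Q.brk_succ j
  obtain ⟨⟨ha1, ha2⟩, ha3, ha4⟩ := ha
  obtain ⟨⟨hb1, hb2⟩, hb3, hb4⟩ := hb
  have := bilinear_sub_le (α := (a.1 - P.brk i) / P.edgeLen i)
    (α' := (b.1 - P.brk i) / P.edgeLen i) (β := (a.2 - Q.brk j) / Q.edgeLen j)
    (β' := (b.2 - Q.brk j) / Q.edgeLen j) (div_nonneg (by linarith) hq.le)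
    ((div_le_one hq).2 (by linarith)) (div_nonneg (by linarith) hp.le)
    ((div_le_one hp).2 (by linarith))
    (div_le_div_of_nonneg_right (by linarith [hab.1]) hp.le)
    (div_le_div_of_nonneg_right (by linarith [hab.2]) hq.le)
    (gridDist_succ_left_le P Q hi hj.le hj (Or.inl rfl))
    (gridDist_succ_left_le P Q hi hj hj (Or.inr rfl))
    (gridDist_succ_right_le P Q hi.le hj hi (Or.inl rfl))
    (gridDist_succ_right_le P Q hi hj hi (Or.inr rfl))
  rw [potential, potential, interp_eq _ _ hi ⟨ha1, ha2⟩, interp_eq _ _ hi ⟨hb1, hb2⟩,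
    interp_eq _ _ hj ⟨ha3, ha4⟩, interp_eq _ _ hj ⟨ha3, ha4⟩,
    interp_eq _ _ hj ⟨hb3, hb4⟩, interp_eq _ _ hj ⟨hb3, hb4⟩]
  simp only [smul_eq_mul]
  refine this.trans_eq ?_
  field_simp
  ring

/-! ### Refinements -/

namespace PolyCurve

/-- Since `t i` is monotone, the new vertices never backtrack along the edge, so the distances
between them add up without cancellation. -/
lemma brk_refinement {P P' : PolyCurve d} {φ : ℕ → ℕ} {t : ℕ → ℕ → ℝ} {i : ℕ}
    (h0 : t i (φ i) = 0) (hb : P'.brk (φ i) = P.brk i)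
    (ht : MonotoneOn (t i) (Set.Icc (φ i) (φ (i + 1))))
    (hv : ∀ k ∈ Set.Icc (φ i) (φ (i + 1)),
      P'.vtx k = AffineMap.lineMap (P.vtx i) (P.vtx (i + 1)) (t i k)) {k : ℕ}
    (hk : φ i ≤ k) (hk' : k ≤ φ (i + 1)) : P'.brk k = P.brk i + t i k * P.edgeLen i := by
  induction k, hk using Nat.le_induction with
  | base => rw [hb, h0]; ring
  | succ k hk ih =>
    have hk1 : k ∈ Set.Icc (φ i) (φ (i + 1)) := ⟨hk, by omega⟩
    have hk2 : k + 1 ∈ Set.Icc (φ i) (φ (i + 1)) := ⟨by omega, hk'⟩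
    have he : P'.edgeLen k = (t i (k + 1) - t i k) * P.edgeLen i := by
      unfold edgeLen
      rw [hv _ hk1, hv _ hk2, dist_lineMap_lineMap, dist_comm, Real.dist_eq,
        abs_of_nonneg (sub_nonneg.2 (ht hk1 hk2 k.le_succ))]
    rw [brk_succ, ih hk1.2, he]
    ring

lemma IsRefinement.len_eq_and_edge {P P' : PolyCurve d} (h : P.IsRefinement P') :
    P'.len = P.len ∧ ∀ k < P'.n, ∃ i < P.n, P.brk i ≤ P'.brk k ∧ P'.brk (k + 1) ≤ P.brk (i + 1) ∧
      ∀ x ∈ Set.Icc (P'.brk k) (P'.brk (k + 1)), P'.param x = P.param x := by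
  obtain ⟨φ, t, hφ0, hφn, h⟩ := h
  have hb : ∀ i ≤ P.n, P'.brk (φ i) = P.brk i := by
    intro i
    induction i with
    | zero => intro; rw [hφ0, brk_zero, brk_zero]
    | succ i ih =>
      intro hi
      obtain ⟨h1, h2, h3, h4, h5⟩ := h i hi
      rw [brk_refinement h2 (ih (by omega)) h4 h5 h1.le le_rfl, h3, brk_succ, one_mul]
  refine ⟨by rw [len, ← hφn, hb _ le_rfl]; rfl, fun k hk => ?_⟩
  have key : ∀ m ≤ P.n, k < φ m → ∃ i < P.n, φ i ≤ k ∧ k < φ (i + 1) := by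
    intro m
    induction m with
    | zero => intro _ h; omega
    | succ m ih =>
      intro hm hk
      by_cases hkm : φ m ≤ k
      · exact ⟨m, hm, hkm, hk⟩
      · exact ih (by omega) (by omega)
  obtain ⟨i, hi, hik, hki⟩ := key P.n le_rfl (by omega)
  obtain ⟨h1, h2, h3, h4, h5⟩ := h i hi
  have hbk := brk_refinement h2 (hb i hi.le) h4 h5 hik hki.le
  have hbk' := brk_refinement h2 (hb i hi.le) h4 h5 (hik.trans k.le_succ) hki
  have hle : P.brk i ≤ P'.brk k := hb i hi.le ▸ P'.brk_mono hik
  have hge : P'.brk (k + 1) ≤ P.brk (i + 1) := hb (i + 1) hi ▸ P'.brk_mono hki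
  refine ⟨i, hi, hle, hge, fun x hx => ?_⟩
  have he := P.edgeLen_pos hi
  have he' := P'.edgeLen_pos hk
  have hlen : P'.edgeLen k = (t i (k + 1) - t i k) * P.edgeLen i := by
    have := P'.brk_succ k
    rw [hbk, hbk'] at this
    linarith
  -- Consecutive vertices of `P'` are distinct, so the fraction does advance.
  have hΔ : t i (k + 1) - t i k ≠ 0 := fun h0 => by rw [hlen, h0, zero_mul] at he'; exact he'.false
  rw [param_eq_interp, param_eq_interp, interp_eq _ _ hk hx,
    interp_eq _ _ hi ⟨hle.trans hx.1, hx.2.trans hge⟩, h5 k ⟨hik, hki.le⟩,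
    h5 (k + 1) ⟨hik.trans k.le_succ, hki⟩, AffineMap.lineMap_apply_module',
    AffineMap.lineMap_apply_module', add_sub_add_right_eq_sub, ← sub_smul, smul_smul,
    add_comm _ (P.vtx i), add_assoc, ← add_smul, hlen, hbk]
  congr 2
  field_simp
  ring

lemma IsRefinement.len_eq {P P' : PolyCurve d} (h : P.IsRefinement P') : P'.len = P.len :=
  h.len_eq_and_edge.1

lemma IsRefinement.vtx_zero {P P' : PolyCurve d} (h : P.IsRefinement P') :
    P'.vtx 0 = P.vtx 0 := by
  obtain ⟨φ, t, hφ0, -, h⟩ := h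
  obtain ⟨h1, h2, -, -, h5⟩ := h 0 P.n_pos
  have := h5 _ ⟨le_rfl, h1.le⟩
  rwa [h2, AffineMap.lineMap_apply_zero, hφ0] at this

lemma IsRefinement.vtx_last {P P' : PolyCurve d} (h : P.IsRefinement P') :
    P'.vtx P'.n = P.vtx P.n := by
  obtain ⟨φ, t, -, hφn, h⟩ := h
  have hn : P.n - 1 + 1 = P.n := Nat.sub_add_cancel P.n_pos
  obtain ⟨h1, -, h3, -, h5⟩ := h (P.n - 1) (by omega)
  have := h5 _ ⟨h1.le, le_rfl⟩
  rwa [h3, AffineMap.lineMap_apply_one, hn, hφn] at this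

lemma IsRefinement.param_eq {P P' : PolyCurve d} (h : P.IsRefinement P') : P'.param = P.param := by
  funext x
  rcases le_total x 0 with hx | hx
  · rw [param_eq_interp, param_eq_interp, interp_of_nonpos _ _ hx, interp_of_nonpos _ _ hx,
      h.vtx_zero]
  rcases le_total P'.len x with hx' | hx'
  · rw [param_eq_interp, param_eq_interp, interp_of_len_le _ _ hx',
      interp_of_len_le _ _ (h.len_eq ▸ hx'), h.vtx_last]
  · obtain ⟨k, hk, hxk, -⟩ := P'.exists_edge_right hx hx'
    obtain ⟨i, -, -, -, hi⟩ := h.len_eq_and_edge.2 k hk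
    exact hi x hxk

/-! ### Splitting as a refinement -/

lemma edgeLen_split (P : PolyCurve d) (k : ℕ) : P.split.edgeLen k = P.edgeLen (k / 2) / 2 := by
  unfold edgeLen
  change dist (midpoint ℝ (P.vtx (k / 2)) (P.vtx ((k + 1) / 2)))
    (midpoint ℝ (P.vtx ((k + 1) / 2)) (P.vtx ((k + 1 + 1) / 2))) = _
  rcases Nat.even_or_odd' k with ⟨c, rfl | rfl⟩
  · have h1 : 2 * c / 2 = c := by omega
    have h2 : (2 * c + 1) / 2 = c := by omega
    have h3 : (2 * c + 1 + 1) / 2 = c + 1 := by omega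
    rw [h1, h2, h3, midpoint_self, dist_left_midpoint]
    norm_num
    ring
  · have h1 : (2 * c + 1) / 2 = c := by omega
    have h2 : (2 * c + 1 + 1) / 2 = c + 1 := by omega
    have h3 : (2 * c + 1 + 1 + 1) / 2 = c + 1 := by omega
    rw [h1, h2, h3, midpoint_self, dist_midpoint_right]
    norm_num
    ring

lemma isRefinement_split (P : PolyCurve d) : P.IsRefinement P.split := by
  refine ⟨fun i => 2 * i, fun i k => ((k : ℝ) - 2 * i) / 2, rfl, rfl, fun i hi => ⟨by grind, ?_, ?_,
    ?_, ?_⟩⟩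
  · push_cast; ring
  · push_cast; ring
  · intro k _ l _ hkl
    have : (k : ℝ) ≤ l := by exact_mod_cast hkl
    simp only
    linarith
  · rintro k ⟨hk1, hk2⟩
    change midpoint ℝ (P.vtx (k / 2)) (P.vtx ((k + 1) / 2)) = _
    obtain rfl | rfl | rfl : k = 2 * i ∨ k = 2 * i + 1 ∨ k = 2 * i + 2 := by grind
    · have h2 : (2 * i + 1) / 2 = i := by omega
      simp [h2]
    · have h1 : (2 * i + 1) / 2 = i := by omega
      have h2 : (2 * i + 1 + 1) / 2 = i + 1 := by omega
      rw [h1, h2, midpoint]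
      congr 1
      push_cast
      rw [invOf_eq_inv]
      ring
    · have h1 : (2 * i + 2) / 2 = i + 1 := by omega
      have h2 : (2 * i + 2 + 1) / 2 = i + 1 := by omega
      rw [h1, h2, midpoint_self]
      have : (((2 * i + 2 : ℕ) : ℝ) - 2 * i) / 2 = 1 := by push_cast; ring
      simp only [this, AffineMap.lineMap_apply_one]

lemma split_iterate (P : PolyCurve d) (i : ℕ) :
    (split^[i] P).len = P.len ∧ (split^[i] P).param = P.param ∧
      ∀ k < (split^[i] P).n, (split^[i] P).edgeLen k ≤ P.len / 2 ^ i := by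
  induction i with
  | zero =>
    refine ⟨rfl, rfl, fun k hk => ?_⟩
    rw [pow_zero, div_one]
    change P.edgeLen k ≤ P.brk P.n
    linarith [P.brk_mono (show k + 1 ≤ P.n from hk), P.brk_succ k, P.brk_nonneg k]
  | succ i ih =>
    obtain ⟨h1, h2, h3⟩ := ih
    have h := isRefinement_split (split^[i] P)
    rw [Function.iterate_succ_apply']
    refine ⟨h.len_eq.trans h1, h.param_eq.trans h2, fun k hk => ?_⟩
    have hk : k < 2 * (split^[i] P).n := hk
    have := h3 (k / 2) (by omega)
    rw [edgeLen_split, pow_succ, ← div_div]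
    linarith

end PolyCurve

/-! ### Monotonicity of the lower bound under refinement -/

lemma IsRefinement.exists_cell {P P' Q Q' : PolyCurve d} (hP : P.IsRefinement P')
    (hQ : Q.IsRefinement Q') {k l : ℕ} (hk : k < P'.n) (hl : l < Q'.n) :
    ∃ i < P.n, ∃ j < Q.n, cell P' Q' k l ⊆ cell P Q i j ∧ flat P Q i j ≤ flat P' Q' k l := by
  obtain ⟨i, hi, h1, h2, -⟩ := hP.len_eq_and_edge.2 k hk
  obtain ⟨j, hj, h3, h4, -⟩ := hQ.len_eq_and_edge.2 l hl
  have hsub : cell P' Q' k l ⊆ cell P Q i j :=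
    Set.prod_mono (Set.Icc_subset_Icc h1 h2) (Set.Icc_subset_Icc h3 h4)
  refine ⟨i, hi, j, hj, hsub, le_flat _ _ fun z hz => ?_⟩
  rw [elev, hP.param_eq, hQ.param_eq]
  exact flat_le_elev P Q (hsub hz)

/-- The potential of the coarse grid is evaluated at the vertices of the fine one. A fine edge lies
in a coarse cell along with each fine cell adjacent to it, and the coarse `flat` is no larger than
the fine one. -/
lemma lowerBound_le_of_isRefinement {P P' Q Q' : PolyCurve d} (hP : P.IsRefinement P')
    (hQ : Q.IsRefinement Q') : lowerBound P Q ≤ lowerBound P' Q' := by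
  obtain ⟨l, hl⟩ := exists_gridPath P' Q' le_rfl le_rfl
  refine le_csInf ⟨_, l, hl, rfl⟩ ?_
  rintro _ ⟨l, hl, rfl⟩
  have key := potential_sub_le_pathWeight (w := gridWeight P' Q')
    (φ := fun a : ℕ × ℕ => potential P Q (P'.brk a.1, Q'.brk a.2)) ?_ l _ hl
  · have h1 := potential_end P Q
    have h2 := potential_origin_nonpos P Q
    change potential P Q (P'.len, Q'.len) - potential P Q (P'.brk 0, Q'.brk 0) ≤ _ at key
    rw [hP.len_eq, hQ.len_eq, brk_zero, brk_zero] at key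
    linarith
  · rintro ⟨k, l⟩ ⟨k', l'⟩ ⟨hk, hl, h⟩
    simp only [Prod.mk.injEq] at hk hl h
    rcases h with ⟨rfl, rfl⟩ | ⟨rfl, rfl⟩
    · have he := P'.edgeLen_pos hk
      rw [gridWeight_right, mul_comm, ← div_le_iff₀ he]
      refine le_hFlat P' Q' hl fun j' hj' h => ?_
      obtain ⟨i, hi, j, hj, hsub, hflat⟩ := IsRefinement.exists_cell hP hQ (k := k) hk hj'
      have hmem : Q'.brk l' ∈ Set.Icc (Q'.brk j') (Q'.brk (j' + 1)) :=
        ⟨Q'.brk_mono (by omega), Q'.brk_mono (by omega)⟩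
      have hs := P'.brk_succ k
      have := potential_sub_le P Q hi hj (a := (P'.brk k, Q'.brk l'))
        (b := (P'.brk (k + 1), Q'.brk l')) (hsub ⟨⟨le_rfl, P'.brk_mono k.le_succ⟩, hmem⟩)
        (hsub ⟨⟨P'.brk_mono k.le_succ, le_rfl⟩, hmem⟩) ⟨P'.brk_mono k.le_succ, le_rfl⟩
      rw [div_le_iff₀ he]
      refine this.trans ?_
      simp only [sub_self, add_zero]
      rw [hs, add_sub_cancel_left]
      exact mul_le_mul_of_nonneg_right hflat he.le
    · have he := Q'.edgeLen_pos hl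
      rw [gridWeight_up, mul_comm, ← div_le_iff₀ he]
      refine le_vFlat P' Q' hk fun i' hi' h => ?_
      obtain ⟨i, hi, j, hj, hsub, hflat⟩ := IsRefinement.exists_cell hP hQ (l := l) hi' hl
      have hmem : P'.brk k' ∈ Set.Icc (P'.brk i') (P'.brk (i' + 1)) :=
        ⟨P'.brk_mono (by omega), P'.brk_mono (by omega)⟩
      have hs := Q'.brk_succ l
      have := potential_sub_le P Q hi hj (a := (P'.brk k', Q'.brk l))
        (b := (P'.brk k', Q'.brk (l + 1))) (hsub ⟨hmem, ⟨le_rfl, Q'.brk_mono l.le_succ⟩⟩)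
        (hsub ⟨hmem, ⟨Q'.brk_mono l.le_succ, le_rfl⟩⟩) ⟨le_rfl, Q'.brk_mono l.le_succ⟩
      rw [div_le_iff₀ he]
      refine this.trans ?_
      simp only [sub_self, zero_add]
      rw [hs, add_sub_cancel_left]
      exact mul_le_mul_of_nonneg_right hflat he.le

/-! ### The sweep distance -/

/-- A portal moved to a corner still lies on its own grid edge. -/
lemma IsHPortal.mem {P Q : PolyCurve d} {i j : ℕ} {z : ℝ × ℝ} (h : IsHPortal P Q i j z) :
    z.1 ∈ Set.Icc (P.brk i) (P.brk (i + 1)) ∧ z.2 = Q.brk j := by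
  unfold IsHPortal at h
  split_ifs at h with h1 h2
  · obtain ⟨rfl, rfl⟩ := h1
    subst h
    exact ⟨⟨P.brk_zero.le, P.brk_nonneg _⟩, Q.brk_zero.symm⟩
  · obtain ⟨h2, rfl⟩ := h2
    subst h
    exact ⟨⟨P.brk_mono (by omega), by rw [h2]; rfl⟩, rfl⟩
  · exact ⟨h.1, h.2.1⟩

lemma IsVPortal.mem {P Q : PolyCurve d} {i j : ℕ} {z : ℝ × ℝ} (h : IsVPortal P Q i j z) :
    z.1 = P.brk i ∧ z.2 ∈ Set.Icc (Q.brk j) (Q.brk (j + 1)) := by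
  unfold IsVPortal at h
  split_ifs at h with h1 h2
  · obtain ⟨rfl, rfl⟩ := h1
    subst h
    exact ⟨P.brk_zero.symm, ⟨Q.brk_zero.le, Q.brk_nonneg _⟩⟩
  · obtain ⟨rfl, h2⟩ := h2
    subst h
    exact ⟨rfl, ⟨Q.brk_mono (by omega), by rw [h2]; rfl⟩⟩
  · exact ⟨h.1, h.2.1⟩

lemma veEdge.exists_cell {P Q : PolyCurve d} {a b : ℝ × ℝ} (h : veEdge P Q a b) :
    ∃ i < P.n, ∃ j < Q.n, a ∈ cell P Q i j ∧ b ∈ cell P Q i j := by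
  obtain ⟨-, i, hi, j, hj, ha, hb⟩ := h
  refine ⟨i, hi, j, hj, ?_, ?_⟩
  · rcases ha with ha | ha
    · exact ⟨ha.mem.1, by rw [ha.mem.2]; exact ⟨le_rfl, Q.brk_mono j.le_succ⟩⟩
    · exact ⟨by rw [ha.mem.1]; exact ⟨le_rfl, P.brk_mono i.le_succ⟩, ha.mem.2⟩
  · rcases hb with hb | hb
    · exact ⟨hb.mem.1, by rw [hb.mem.2]; exact ⟨Q.brk_mono j.le_succ, le_rfl⟩⟩
    · exact ⟨by rw [hb.mem.1]; exact ⟨P.brk_mono i.le_succ, le_rfl⟩, hb.mem.2⟩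

lemma convex_cell (P Q : PolyCurve d) (i j : ℕ) : Convex ℝ (cell P Q i j) :=
  (convex_Icc _ _).prod (convex_Icc _ _)

/-- By convexity the segment stays in the cell, so its mean elevation is at least `flat`. -/
lemma flat_mul_le_segPrice (P Q : PolyCurve d) {i j : ℕ} {a b : ℝ × ℝ} (ha : a ∈ cell P Q i j)
    (hb : b ∈ cell P Q i j) (hab : a ≤ b) :
    flat P Q i j * ((b.1 - a.1) + (b.2 - a.2)) ≤ segPrice P Q a b := by
  have h : flat P Q i j ≤ ∫ t in (0 : ℝ)..1, elev P Q (AffineMap.lineMap a b t) := by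
    have := intervalIntegral.integral_mono_on (zero_le_one (α := ℝ))
      (f := fun _ => flat P Q i j) (g := fun t => elev P Q (AffineMap.lineMap a b t))
      (μ := MeasureTheory.volume) (by simp)
      (((continuous_elev P Q).comp AffineMap.lineMap_continuous).intervalIntegrable _ _)
      fun t ht => flat_le_elev P Q ((convex_cell P Q i j).lineMap_mem ha hb ht)
    simpa using this
  have h1 := sub_nonneg.2 hab.1
  have h2 := sub_nonneg.2 hab.2
  rw [segPrice, ← add_mul, abs_of_nonneg h1, abs_of_nonneg h2, mul_comm]
  exact mul_le_mul_of_nonneg_left h (add_nonneg h1 h2)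

theorem lowerBound_le_of_isSweepDistance {P Q : PolyCurve d} {w : ℝ}
    (h : IsSweepDistance P Q w) : lowerBound P Q ≤ w := by
  induction h with
  | output P Q l hl hmono =>
    obtain ⟨h1, h2, h3⟩ := hl.1
    -- Monotonicity is put into the edge relation, as the growth of the potential is controlled only
    -- for `a ≤ b`.
    have hchain : l.IsChain fun a b => veEdge P Q a b ∧ a ≤ b := by
      rw [List.isChain_iff_getElem] at h1 hmono ⊢
      exact fun i hi => ⟨h1 i hi, hmono i hi⟩
    have key := potential_sub_le_pathWeight (w := segPrice P Q) (φ := potential P Q) ?_ l (0, 0)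
      ⟨hchain, h2, h3⟩
    · have := potential_end P Q
      have := potential_origin_nonpos P Q
      linarith
    · rintro a b ⟨hab, hle⟩
      obtain ⟨i, hi, j, hj, ha, hb⟩ := hab.exists_cell
      exact (potential_sub_le P Q hi hj ha hb hle).trans (flat_mul_le_segPrice P Q ha hb hle)
  | refine P Q P' Q' l w _ _ hP hQ _ ih => exact (lowerBound_le_of_isRefinement hP hQ).trans ih

/-! ### Monotone curves parameterized by the `L¹` arc length -/

/-- `X` is the first coordinate of a monotone curve `s ↦ (X s, s - X s)`. -/
structure IsMonoPath (X : ℝ → ℝ) : Prop where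
  mono : Monotone X
  mono' : Monotone fun s => s - X s

/-- The monotone curve with first coordinate `X`. -/
def monoPath (X : ℝ → ℝ) (s : ℝ) : ℝ × ℝ := (X s, s - X s)

namespace IsMonoPath

variable {X : ℝ → ℝ} (hX : IsMonoPath X)

include hX

/-- `X` and `s - X s` both being monotone makes `X` 1-Lipschitz. -/
lemma continuous : Continuous X := by
  refine (LipschitzWith.of_le_add fun s t => ?_).continuous
  rcases le_total s t with h | h
  · have := hX.mono h
    have := dist_nonneg (x := s) (y := t)
    linarith
  · have := hX.mono' h
    rw [Real.dist_eq, abs_of_nonneg (sub_nonneg.2 h)]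
    simp only at this
    linarith

lemma continuous_monoPath : Continuous (monoPath X) :=
  hX.continuous.prodMk (continuous_id.sub hX.continuous)

lemma monotone_monoPath : Monotone (monoPath X) := fun _ _ h => ⟨hX.mono h, hX.mono' h⟩

lemma symm : IsMonoPath fun s => s - X s :=
  ⟨hX.mono', by simpa using hX.mono⟩

end IsMonoPath

/-- The potential is a lower bound for the elevation integral along monotone curves. -/
lemma lowerBound_le_integral (P Q : PolyCurve d) {X : ℝ → ℝ} (hX : IsMonoPath X) (h0 : X 0 = 0)
    (h1 : X (P.len + Q.len) = P.len) :
    lowerBound P Q ≤ ∫ s in (0 : ℝ)..(P.len + Q.len), elev P Q (monoPath X s) := by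
  set L := P.len + Q.len with hL
  have hL0 : 0 ≤ L := add_nonneg P.len_nonneg Q.len_nonneg
  have hc : Continuous fun s => elev P Q (monoPath X s) :=
    (continuous_elev P Q).comp hX.continuous_monoPath
  have hB : ∀ s, HasDerivAt (fun s => potential P Q (0, 0) +
      ∫ u in (0 : ℝ)..s, elev P Q (monoPath X u)) (elev P Q (monoPath X s)) s := fun s =>
    (intervalIntegral.integral_hasDerivAt_right (hc.intervalIntegrable _ _)
      hc.aestronglyMeasurable.stronglyMeasurableAtFilter hc.continuousAt).const_add _
  have he : monoPath X L = (P.len, Q.len) := by rw [monoPath, h1, hL, add_sub_cancel_left]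
  -- The potential need not be differentiable along the curve; it suffices to bound its right slopes
  -- by the derivative of the elevation integral.
  have key := image_le_of_liminf_slope_right_le_deriv_boundary (a := 0) (b := L)
    (f := fun s => potential P Q (monoPath X s))
    (B := fun s => potential P Q (0, 0) + ∫ u in (0 : ℝ)..s, elev P Q (monoPath X u))
    (B' := fun s => elev P Q (monoPath X s))
    ((continuous_potential P Q).comp hX.continuous_monoPath).continuousOn
    (by simp [monoPath, h0]) (fun s _ => (hB s).continuousAt.continuousWithinAt)
    (fun s _ => (hB s).hasDerivWithinAt) ?_ (x := L) ⟨hL0, le_rfl⟩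
  · rw [he, potential_end] at key
    have := potential_origin_nonpos P Q
    linarith
  · intro s hs r hr
    refine Eventually.frequently ?_
    have hx0 : 0 ≤ X s := h0 ▸ hX.mono hs.1
    have hy0 : 0 ≤ s - X s := by simpa [h0] using hX.mono' hs.1
    have hx1 : ∀ t ≤ L, X t ≤ P.len := fun t ht => h1 ▸ hX.mono ht
    have hy1 : ∀ t ≤ L, t - X t ≤ Q.len := fun t ht => by
      have := hX.mono' ht
      simp only [h1] at this
      linarith
    -- One cell contains the curve at `s` and just after `s`, so the slope there is at most `flat`,
    -- hence at most the elevation at `s`.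
    obtain ⟨i, hi, hxi, δ, hδ, hi'⟩ := P.exists_edge_right hx0 (hx1 s hs.2.le)
    obtain ⟨j, hj, hyj, ε, hε, hj'⟩ := Q.exists_edge_right hy0 (hy1 s hs.2.le)
    have hnear : Set.Ioo s (min L (s + min δ ε)) ∈ 𝓝[>] s :=
      Ioo_mem_nhdsGT (lt_min hs.2 (by linarith [lt_min hδ hε]))
    filter_upwards [hnear] with t ht
    have ht1 : t < L := ht.2.trans_le (min_le_left _ _)
    have ht2 : t < s + min δ ε := ht.2.trans_le (min_le_right _ _)
    have hxt := hX.mono ht.1.le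
    have hyt := hX.mono' ht.1.le
    simp only at hyt
    have hmin1 := min_le_left δ ε
    have hmin2 := min_le_right δ ε
    have hmem : monoPath X t ∈ cell P Q i j :=
      ⟨hi' (X t) hxt (hx1 t ht1.le) (by linarith), hj' (t - X t) hyt (hy1 t ht1.le) (by linarith)⟩
    have hmem' : monoPath X s ∈ cell P Q i j := ⟨hxi, hyj⟩
    have h2 := potential_sub_le P Q hi hj hmem' hmem (hX.monotone_monoPath ht.1.le)
    refine lt_of_le_of_lt ?_ hr
    rw [slope_def_field, div_le_iff₀ (sub_pos.2 ht.1)]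
    refine h2.trans ?_
    have h3 : (monoPath X t).1 - (monoPath X s).1 + ((monoPath X t).2 - (monoPath X s).2) =
        t - s := by
      simp only [monoPath]; ring
    rw [h3]
    exact mul_le_mul_of_nonneg_right (flat_le_elev P Q hmem') (sub_pos.2 ht.1).le

/-! ### The warping cost as an integral along the curve -/

open MeasureTheory

/-- A right inverse of a monotone function pushes Lebesgue measure forward to the measure whose
distribution function is the given function. -/
lemma map_section_Iic {X S : ℝ → ℝ} {p L : ℝ} (hX : Monotone X) (h1 : X L = p)
    (hS : MonotoneOn S (Set.Icc 0 p)) (hSX : ∀ x ∈ Set.Icc 0 p, X (S x) = x) {a : ℝ}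
    (haL : a ≤ L) :
    (volume.restrict (Set.Icc 0 p)).map S (Set.Iic a) = ENNReal.ofReal (X a) := by
  have hXa : X a ≤ p := h1 ▸ hX haL
  rw [Measure.map_apply_of_aemeasurable (aemeasurable_restrict_of_monotoneOn measurableSet_Icc hS)
    measurableSet_Iic, Measure.restrict_apply' measurableSet_Icc]
  -- Within `[0, p]`, the set `S ≤ a` lies between `[0, X a)` and `[0, X a]`.
  apply le_antisymm
  · refine (measure_mono (t := Set.Icc 0 (X a)) ?_).trans_eq (by simp)
    rintro x ⟨hx, hx'⟩
    exact ⟨hx'.1, hSX x hx' ▸ hX hx⟩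
  · refine le_trans (by simp) (measure_mono (s := Set.Ico 0 (X a)) ?_)
    rintro x ⟨hx, hx'⟩
    have hxp : x ∈ Set.Icc 0 p := ⟨hx, hx'.le.trans hXa⟩
    have hle : S x ≤ a := by
      by_contra! h
      have := hX h.le
      rw [hSX x hxp] at this
      linarith
    exact ⟨hle, hxp⟩

lemma exists_section {X : ℝ → ℝ} {p L : ℝ} (hX : Monotone X) (hc : Continuous X) (h0 : X 0 = 0)
    (h1 : X L = p) (hL : 0 ≤ L) :
    ∃ S : ℝ → ℝ, MonotoneOn S (Set.Icc 0 p) ∧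
      ∀ x ∈ Set.Icc 0 p, S x ∈ Set.Icc 0 L ∧ X (S x) = x := by
  have h : ∀ x ∈ Set.Icc 0 p, ∃ s ∈ Set.Icc 0 L, X s = x := by
    have := intermediate_value_Icc hL hc.continuousOn
    rw [h0, h1] at this
    exact fun x hx => this hx
  choose! S hS using h
  refine ⟨S, fun x hx y hy hxy => ?_, hS⟩
  by_contra! hlt
  have := hX hlt.le
  rw [(hS x hx).2, (hS y hy).2] at this
  obtain rfl := le_antisymm hxy this
  exact hlt.false

/-- The two pushforwards have distribution functions `X a` and `a - X a`, whose sum is `a`. This is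
the identity `dx + dy = ds` along the curve, valid across horizontal and vertical pieces. -/
lemma map_section_add {X S T : ℝ → ℝ} {p q : ℝ} (hX : IsMonoPath X) (h0 : X 0 = 0)
    (h1 : X (p + q) = p) (hS : MonotoneOn S (Set.Icc 0 p))
    (hSX : ∀ x ∈ Set.Icc 0 p, S x ∈ Set.Icc 0 (p + q) ∧ X (S x) = x)
    (hT : MonotoneOn T (Set.Icc 0 q))
    (hTX : ∀ y ∈ Set.Icc 0 q, T y ∈ Set.Icc 0 (p + q) ∧ T y - X (T y) = y) (hL : 0 ≤ p + q) :
    (volume.restrict (Set.Icc 0 p)).map S + (volume.restrict (Set.Icc 0 q)).map T =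
      volume.restrict (Set.Icc 0 (p + q)) := by
  have hSm := aemeasurable_restrict_of_monotoneOn (μ := volume) measurableSet_Icc hS
  have hTm := aemeasurable_restrict_of_monotoneOn (μ := volume) measurableSet_Icc hT
  have hpq : ∀ a, 0 ≤ a → a ≤ p + q →
      ((volume.restrict (Set.Icc 0 p)).map S + (volume.restrict (Set.Icc 0 q)).map T)
        (Set.Iic a) = ENNReal.ofReal a := by
    intro a ha ha'
    have hx0 : 0 ≤ X a := h0 ▸ hX.mono ha
    have hy0 : 0 ≤ a - X a := by simpa [h0] using hX.mono' ha
    rw [Measure.add_apply, map_section_Iic hX.mono h1 hS (fun x hx => (hSX x hx).2) ha',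
      map_section_Iic (X := fun s => s - X s) (L := p + q) hX.mono'
        (by simp [h1]) hT (fun y hy => (hTX y hy).2) ha', ← ENNReal.ofReal_add hx0 hy0]
    congr 1
    ring
  have hae : ∀ᵐ s ∂((volume.restrict (Set.Icc 0 p)).map S +
      (volume.restrict (Set.Icc 0 q)).map T), s ∈ Set.Icc 0 (p + q) := by
    refine ae_add_measure_iff.2 ⟨(ae_map_iff hSm measurableSet_Icc).2 ?_,
      (ae_map_iff hTm measurableSet_Icc).2 ?_⟩
    · exact (ae_restrict_iff' measurableSet_Icc).2 (ae_of_all _ fun x hx => (hSX x hx).1)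
    · exact (ae_restrict_iff' measurableSet_Icc).2 (ae_of_all _ fun x hx => (hTX x hx).1)
  refine Measure.ext_of_Iic _ _ fun a => ?_
  rw [Measure.restrict_apply' measurableSet_Icc]
  rcases lt_or_ge a 0 with ha | ha
  · rw [measure_eq_zero_iff_ae_notMem.2 (hae.mono fun s hs h => ?_),
      Set.eq_empty_of_forall_notMem (s := Set.Iic a ∩ Set.Icc 0 (p + q)) ?_, measure_empty]
    · rintro x ⟨hx, hx', -⟩
      exact (hx'.trans hx).not_gt ha
    · exact (hs.1.trans h).not_gt ha
  · have hvol : Set.Iic a ∩ Set.Icc 0 (p + q) = Set.Icc 0 (min a (p + q)) := by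
      ext x; simp only [Set.mem_inter_iff, Set.mem_Iic, Set.mem_Icc, le_min_iff]; tauto
    rw [hvol, Real.volume_Icc, sub_zero, ← hpq _ (le_min ha hL) (min_le_right _ _)]
    refine measure_congr (hae.mono fun s hs => ?_)
    simp only [eq_iff_iff]
    change s ≤ a ↔ s ≤ min a (p + q)
    rw [le_min_iff]
    exact ⟨fun h => ⟨h, hs.2⟩, fun h => h.1⟩

/-- A monotone function takes only countably many values more than once. For almost every `x` the
fiber is therefore the single point `S x`, and the infimum is a plain value. -/
lemma integral_sInf_fiber {X S : ℝ → ℝ} {p L : ℝ} {F G : ℝ → ℝ} (hX : Monotone X) (hp : 0 ≤ p)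
    (hS : MonotoneOn S (Set.Icc 0 p)) (hSX : ∀ x ∈ Set.Icc 0 p, S x ∈ Set.Icc 0 L ∧ X (S x) = x)
    (hF : Continuous F)
    (hG : ∀ x, G x = sInf {r | ∃ s ∈ Set.Icc 0 L, X s = x ∧ r = F s}) :
    ∫ x in (0 : ℝ)..p, G x = ∫ s, F s ∂((volume.restrict (Set.Icc 0 p)).map S) := by
  rw [integral_map (aemeasurable_restrict_of_monotoneOn measurableSet_Icc hS)
    hF.aestronglyMeasurable, intervalIntegral.integral_of_le hp, ← integral_Icc_eq_integral_Ioc]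
  refine integral_congr_ae ?_
  have hcount := (hX.countable_setOfPred_two_preimages).ae_notMem (volume.restrict (Set.Icc 0 p))
  filter_upwards [hcount, ae_restrict_mem measurableSet_Icc] with x hx hx'
  obtain ⟨h1, h2⟩ := hSX x hx'
  have : {r | ∃ s ∈ Set.Icc 0 L, X s = x ∧ r = F s} = {F (S x)} := by
    ext r
    constructor
    · rintro ⟨s, hs, hsx, rfl⟩
      have : s = S x := by
        by_contra hne
        rcases lt_or_gt_of_ne hne with h | h
        · exact hx ⟨s, S x, h, hsx, h2⟩
        · exact hx ⟨S x, s, h, h2, hsx⟩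
      rw [this]; rfl
    · rintro rfl
      exact ⟨S x, h1, h2, rfl⟩
  rw [hG, this, csInf_singleton]

lemma warpCost_image_monoPath (P Q : PolyCurve d) {X : ℝ → ℝ} (hX : IsMonoPath X) (h0 : X 0 = 0)
    (h1 : X (P.len + Q.len) = P.len) :
    warpCost P Q (monoPath X '' Set.Icc 0 (P.len + Q.len)) =
      ∫ s in (0 : ℝ)..(P.len + Q.len), elev P Q (monoPath X s) := by
  have hL : 0 ≤ P.len + Q.len := add_nonneg P.len_nonneg Q.len_nonneg
  have hc : Continuous fun s => elev P Q (monoPath X s) :=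
    (continuous_elev P Q).comp hX.continuous_monoPath
  obtain ⟨S, hS, hSX⟩ := exists_section hX.mono hX.continuous h0 h1 hL
  obtain ⟨T, hT, hTX⟩ := exists_section (p := Q.len) hX.mono' hX.symm.continuous
    (by simp [h0]) (by simp [h1]) hL
  have hadd := map_section_add hX h0 h1 hS hSX hT hTX hL
  have hint : Integrable (fun s => elev P Q (monoPath X s))
      (volume.restrict (Set.Icc 0 (P.len + Q.len))) := hc.integrableOn_Icc
  rw [warpCost, integral_sInf_fiber hX.mono P.len_nonneg hS hSX hc,
    integral_sInf_fiber hX.mono' Q.len_nonneg hT hTX hc, ← integral_add_measure, hadd,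
    intervalIntegral.integral_of_le hL, ← integral_Icc_eq_integral_Ioc]
  · rw [← hadd] at hint; exact hint.left_of_add_measure
  · rw [← hadd] at hint; exact hint.right_of_add_measure
  · intro y
    congr 1
    ext r
    constructor
    · rintro ⟨x, ⟨s, hs, hsx⟩, rfl⟩
      exact ⟨s, hs, congrArg Prod.snd hsx, by rw [hsx]⟩
    · rintro ⟨s, hs, hsx, rfl⟩
      have : monoPath X s = (X s, y) := by rw [monoPath, hsx]
      exact ⟨X s, ⟨s, hs, this⟩, by rw [this]⟩
  · intro x
    congr 1
    ext r
    constructor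
    · rintro ⟨y, ⟨s, hs, hsx⟩, rfl⟩
      exact ⟨s, hs, congrArg Prod.fst hsx, by rw [hsx]⟩
    · rintro ⟨s, hs, hsx, rfl⟩
      have : monoPath X s = (x, s - X s) := by rw [monoPath, hsx]
      exact ⟨s - X s, ⟨s, hs, this⟩, by rw [this]⟩

/-! ### Morphings and `L¹` parameterizations -/

lemma PolyCurve.len_pos (P : PolyCurve d) : 0 < P.len := by
  have h1 := P.edgeLen_pos P.n_pos
  have h2 := P.brk_mono (show 0 + 1 ≤ P.n from P.n_pos)
  rw [brk_succ, brk_zero] at h2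
  change 0 < P.brk P.n
  linarith

lemma isMonotoneMorphing_image_monoPath (P Q : PolyCurve d) {X : ℝ → ℝ} (hX : IsMonoPath X)
    (h0 : X 0 = 0) (h1 : X (P.len + Q.len) = P.len) :
    IsMonotoneMorphing P Q (monoPath X '' Set.Icc 0 (P.len + Q.len)) := by
  have hL : 0 < P.len + Q.len := add_pos P.len_pos Q.len_pos
  refine ⟨fun t => monoPath X ((P.len + Q.len) * t),
    (hX.continuous_monoPath.comp (continuous_const_mul _)).continuousOn, ?_,
    (hX.monotone_monoPath.comp (monotone_mul_left_of_nonneg hL.le)).monotoneOn _, ?_, ?_, ?_⟩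
  · intro s _ t _ hst
    obtain ⟨h2, h3⟩ := Prod.ext_iff.1 hst
    simp only [monoPath] at h2 h3
    rw [h2] at h3
    exact mul_left_cancel₀ hL.ne' (sub_left_injective h3)
  · simp [monoPath, h0]
  · simp [monoPath, h1]
  · ext z
    constructor
    · rintro ⟨s, hs, rfl⟩
      refine ⟨s / (P.len + Q.len), ⟨div_nonneg hs.1 hL.le, (div_le_one hL).2 hs.2⟩, ?_⟩
      simp only [mul_div_cancel₀ _ hL.ne']
    · rintro ⟨t, ht, rfl⟩
      exact ⟨_, ⟨mul_nonneg hL.le ht.1, mul_le_of_le_one_right hL.le ht.2⟩, rfl⟩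

lemma IsMonotoneMorphing.exists_monoPath {P Q : PolyCurve d} {m : Set (ℝ × ℝ)}
    (h : IsMonotoneMorphing P Q m) : ∃ X, IsMonoPath X ∧ X 0 = 0 ∧ X (P.len + Q.len) = P.len ∧
      m = monoPath X '' Set.Icc 0 (P.len + Q.len) := by
  have hL : 0 ≤ P.len + Q.len := add_nonneg P.len_nonneg Q.len_nonneg
  obtain ⟨γ, hc, -, hmono, h0, h1, rfl⟩ := h
  have hIVT : ∀ s ∈ Set.Icc 0 (P.len + Q.len), ∃ t ∈ Set.Icc (0 : ℝ) 1, (γ t).1 + (γ t).2 = s := by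
    have := intermediate_value_Icc (zero_le_one (α := ℝ)) (f := fun t => (γ t).1 + (γ t).2)
      ((continuous_fst.comp_continuousOn hc).add (continuous_snd.comp_continuousOn hc))
    simp only [h0, h1, add_zero] at this
    exact fun s hs => this hs
  -- Points of the curve are ordered by their coordinate sum; in particular the sum determines the
  -- point.
  have hle : ∀ t ∈ Set.Icc (0 : ℝ) 1, ∀ u ∈ Set.Icc (0 : ℝ) 1,
      (γ t).1 + (γ t).2 ≤ (γ u).1 + (γ u).2 → γ t ≤ γ u := by
    intro t ht u hu htu
    rcases le_total t u with h | h
    · exact hmono ht hu h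
    · obtain ⟨h2, h3⟩ := hmono hu ht h
      exact ⟨by linarith, by linarith⟩
  choose! τ hτ hτs using hIVT
  -- The clamp `c` extends the curve to all of `ℝ`, as `IsMonoPath` requires.
  let c : ℝ → ℝ := fun s => Set.projIcc 0 (P.len + Q.len) hL s
  have hcm : ∀ s, c s ∈ Set.Icc 0 (P.len + Q.len) := fun s => (Set.projIcc _ _ hL s).2
  have hcid : ∀ s ∈ Set.Icc 0 (P.len + Q.len), c s = s := fun s hs => by
    simp only [c, Set.projIcc_of_mem hL hs]
  have hcmono : Monotone c := fun s t h => Set.monotone_projIcc hL h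
  have hcmono' : ∀ s t, s ≤ t → c t - c s ≤ t - s := fun s t h => by
    simp only [c, Set.coe_projIcc]
    grind
  have hγle : ∀ s t, s ≤ t → γ (τ (c s)) ≤ γ (τ (c t)) := fun s t h =>
    hle _ (hτ _ (hcm s)) _ (hτ _ (hcm t)) (by rw [hτs _ (hcm s), hτs _ (hcm t)]; exact hcmono h)
  have hpath : ∀ t ∈ Set.Icc (0 : ℝ) 1, ∀ s, s = (γ t).1 + (γ t).2 →
      s ∈ Set.Icc 0 (P.len + Q.len) → γ (τ (c s)) = γ t := by
    intro t ht s hs hsI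
    have h2 := hτs _ hsI
    rw [hcid s hsI]
    exact le_antisymm (hle _ (hτ s hsI) _ ht (by linarith)) (hle _ ht _ (hτ s hsI) (by linarith))
  have hz : (0 : ℝ) ∈ Set.Icc (0 : ℝ) 1 := ⟨le_rfl, zero_le_one⟩
  have ho : (1 : ℝ) ∈ Set.Icc (0 : ℝ) 1 := ⟨zero_le_one, le_rfl⟩
  refine ⟨fun s => (γ (τ (c s))).1, ⟨fun s t h => (hγle s t h).1, fun s t h => ?_⟩, ?_, ?_, ?_⟩
  -- Here `s - X s` is the second coordinate plus `s - c s`, and both are monotone.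
  · have h2 := (hγle s t h).2
    have h3 := hτs _ (hcm s)
    have h4 := hτs _ (hcm t)
    have h5 := hcmono' s t h
    simp only
    linarith
  · simp only [hpath 0 hz 0 (by simp [h0]) ⟨le_rfl, hL⟩, h0]
  · simp only [hpath 1 ho (P.len + Q.len) (by simp [h1]) ⟨hL, le_rfl⟩, h1]
  · ext z
    constructor
    · rintro ⟨t, ht, rfl⟩
      have hs : (γ t).1 + (γ t).2 ∈ Set.Icc 0 (P.len + Q.len) := by
        obtain ⟨h2, h3⟩ := hmono hz ht ht.1
        obtain ⟨h4, h5⟩ := hmono ht ho ht.2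
        simp only [h0, h1] at h2 h3 h4 h5
        exact ⟨by linarith, by linarith⟩
      refine ⟨_, hs, ?_⟩
      rw [monoPath, hpath t ht _ rfl hs, add_sub_cancel_left]
    · rintro ⟨s, hs, rfl⟩
      refine ⟨τ s, hτ s hs, ?_⟩
      have := hτs s hs
      rw [monoPath, hcid s hs]
      exact Prod.ext rfl (by simp only; linarith)

lemma lowerBound_le_warpCost {P Q : PolyCurve d} {m : Set (ℝ × ℝ)}
    (h : IsMonotoneMorphing P Q m) : lowerBound P Q ≤ warpCost P Q m := by
  obtain ⟨X, hX, h0, h1, rfl⟩ := h.exists_monoPath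
  rw [warpCost_image_monoPath P Q hX h0 h1]
  exact lowerBound_le_integral P Q hX h0 h1

/-! ### Grid paths as morphings -/

lemma exists_monoPath_cons (f : ℝ × ℝ → ℝ) (hf : Continuous f) {X₁ X₂ : ℝ → ℝ} {a b c : ℝ}
    (h₁ : IsMonoPath X₁) (h₂ : IsMonoPath X₂) (hb : X₁ b = X₂ b) (hab : a ≤ b) (hbc : b ≤ c) :
    ∃ X, IsMonoPath X ∧ X a = X₁ a ∧ X c = X₂ c ∧
      ∫ s in a..c, f (monoPath X s) =
        (∫ s in a..b, f (monoPath X₁ s)) + ∫ s in b..c, f (monoPath X₂ s) := by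
  let X : ℝ → ℝ := fun s => if s ≤ b then X₁ s else X₂ s
  have hle : ∀ s ≤ b, X s = X₁ s := fun s hs => if_pos hs
  have hge : ∀ s, b ≤ s → X s = X₂ s := fun s hs => by
    rcases hs.eq_or_lt with rfl | hs
    · rw [hle _ le_rfl, hb]
    · exact if_neg hs.not_ge
  have hX : IsMonoPath X := by
    constructor <;> intro s t hst <;> rcases le_total t b with ht | ht <;>
      rcases le_total s b with hs | hs <;> simp only [hle, hge, hs, ht]
    · exact h₁.mono hst
    · obtain rfl := le_antisymm ht (hs.trans hst)
      obtain rfl := le_antisymm hst hs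
      rw [hb]
    · exact (h₁.mono hs).trans (hb ▸ h₂.mono ht)
    · exact h₂.mono hst
    · exact h₁.mono' hst
    · obtain rfl := le_antisymm ht (hs.trans hst)
      obtain rfl := le_antisymm hst hs
      rw [hb]
    · have := h₁.mono' hs
      have := h₂.mono' ht
      simp only at *
      linarith
    · exact h₂.mono' hst
  have hc : Continuous fun s => f (monoPath X s) := hf.comp hX.continuous_monoPath
  refine ⟨X, hX, hle a hab, hge c hbc, ?_⟩
  rw [← intervalIntegral.integral_add_adjacent_intervals (hc.intervalIntegrable a b)
    (hc.intervalIntegrable b c)]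
  congr 1
  · refine intervalIntegral.integral_congr fun s hs => ?_
    rw [Set.uIcc_of_le hab] at hs
    simp only [monoPath, hle s hs.2]
  · refine intervalIntegral.integral_congr fun s hs => ?_
    rw [Set.uIcc_of_le hbc] at hs
    simp only [monoPath, hge s hs.1]

/-- Any two points of a cell have leashes whose ends are at most one edge length apart on each
curve. -/
lemma elev_le_flat_add (P Q : PolyCurve d) {i j : ℕ} (hi : i < P.n) (hj : j < Q.n) {δ : ℝ}
    (hδ : P.edgeLen i + Q.edgeLen j ≤ δ) {z : ℝ × ℝ} (hz : z ∈ cell P Q i j) :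
    elev P Q z ≤ flat P Q i j + δ := by
  rw [← sub_le_iff_le_add]
  refine le_flat P Q fun z' hz' => ?_
  have h1 := P.dist_param_le hi hz.1 hz'.1
  have h2 := Q.dist_param_le hj hz'.2 hz.2
  have h3 := dist_triangle4 (P.param z.1) (P.param z'.1) (Q.param z'.2) (Q.param z.2)
  unfold elev
  linarith

lemma integral_le_of_forall_le {f : ℝ → ℝ} (hf : Continuous f) {a b c : ℝ} (hab : a ≤ b)
    (h : ∀ s ∈ Set.Icc a b, f s ≤ c) : ∫ s in a..b, f s ≤ c * (b - a) := by
  have := intervalIntegral.integral_mono_on hab (hf.intervalIntegrable (μ := volume) a b)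
    (g := fun _ => c) (by simp) h
  simpa [mul_comm] using this

/-- A single grid edge, as a monotone curve. -/
lemma exists_monoPath_gridEdge (P Q : PolyCurve d) {δ : ℝ}
    (hδ : ∀ i < P.n, ∀ j < Q.n, P.edgeLen i + Q.edgeLen j ≤ δ) {a b : ℕ × ℕ}
    (h : gridEdge P Q a b) :
    P.brk a.1 + Q.brk a.2 ≤ P.brk b.1 + Q.brk b.2 ∧ ∃ X, IsMonoPath X ∧
      X (P.brk a.1 + Q.brk a.2) = P.brk a.1 ∧ X (P.brk b.1 + Q.brk b.2) = P.brk b.1 ∧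
      ∫ s in (P.brk a.1 + Q.brk a.2)..(P.brk b.1 + Q.brk b.2), elev P Q (monoPath X s) ≤
        gridWeight P Q a b +
          δ * ((P.brk b.1 + Q.brk b.2) - (P.brk a.1 + Q.brk a.2)) := by
  obtain ⟨i, j⟩ := a
  obtain ⟨hi, hj, rfl | rfl⟩ := h
  · simp only at hi hj ⊢
    have hs := P.brk_succ i
    have he := P.edgeLen_pos hi
    have hX : IsMonoPath fun s => s - Q.brk j :=
      ⟨fun s t h => by simpa using h, fun s t h => by simp⟩
    refine ⟨by linarith, _, hX, by simp, by simp, ?_⟩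
    refine (integral_le_of_forall_le ((continuous_elev P Q).comp hX.continuous_monoPath)
      -- The edge lies in every cell adjacent to it, hence also in the one realizing the minimum.
      (by linarith) (c := hFlat P Q i j + δ) fun s hs' => ?_).trans_eq ?_
    · rw [← sub_le_iff_le_add]
      refine le_hFlat P Q hj fun j' hj' h => ?_
      rw [sub_le_iff_le_add]
      refine elev_le_flat_add P Q hi hj' (hδ i hi j' hj') ⟨⟨?_, ?_⟩, ?_⟩
      · simp only [monoPath]; linarith [hs'.1]
      · simp only [monoPath]; linarith [hs'.2]
      · simp only [monoPath, sub_sub_cancel]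
        exact ⟨Q.brk_mono (by omega), Q.brk_mono (by omega)⟩
    · rw [gridWeight_right, hs]; ring
  · simp only at hi hj ⊢
    have hs := Q.brk_succ j
    have he := Q.edgeLen_pos hj
    have hX : IsMonoPath fun _ => P.brk i :=
      ⟨fun s t h => le_rfl, fun s t h => by simpa using h⟩
    refine ⟨by linarith, _, hX, rfl, rfl, ?_⟩
    refine (integral_le_of_forall_le ((continuous_elev P Q).comp hX.continuous_monoPath)
      (by linarith) (c := vFlat P Q i j + δ) fun s hs' => ?_).trans_eq ?_
    · rw [← sub_le_iff_le_add]
      refine le_vFlat P Q hi fun i' hi' h => ?_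
      rw [sub_le_iff_le_add]
      refine elev_le_flat_add P Q hi' hj (hδ i' hi' j hj) ⟨?_, ⟨?_, ?_⟩⟩
      · exact ⟨P.brk_mono (by omega), P.brk_mono (by omega)⟩
      · simp only [monoPath]; linarith [hs'.1]
      · simp only [monoPath]; linarith [hs'.2]
    · rw [gridWeight_up, hs]; ring

lemma exists_monoPath_gridPath (P Q : PolyCurve d) {δ : ℝ}
    (hδ : ∀ i < P.n, ∀ j < Q.n, P.edgeLen i + Q.edgeLen j ≤ δ) {b : ℕ × ℕ} :
    ∀ (l : List (ℕ × ℕ)) (a : ℕ × ℕ), IsPath (gridEdge P Q) a b l →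
    P.brk a.1 + Q.brk a.2 ≤ P.brk b.1 + Q.brk b.2 ∧ ∃ X, IsMonoPath X ∧
      X (P.brk a.1 + Q.brk a.2) = P.brk a.1 ∧ X (P.brk b.1 + Q.brk b.2) = P.brk b.1 ∧
      ∫ s in (P.brk a.1 + Q.brk a.2)..(P.brk b.1 + Q.brk b.2), elev P Q (monoPath X s) ≤
        pathWeight (gridWeight P Q) l +
          δ * ((P.brk b.1 + Q.brk b.2) - (P.brk a.1 + Q.brk a.2))
  | [], a, h => by simp [IsPath] at h
  | [a'], a, h => by
    obtain ⟨-, h1, h2⟩ := h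
    obtain rfl : a' = a := by simpa using h1
    obtain rfl : a' = b := by simpa using h2
    exact ⟨le_rfl, fun _ => P.brk a'.1, ⟨fun s t h => le_rfl, fun s t h => by simpa using h⟩, rfl,
      rfl, by simp [pathWeight]⟩
  | a' :: c :: l, a, h => by
    obtain ⟨h0, h1, h2⟩ := h
    obtain rfl : a' = a := by simpa using h1
    rw [List.isChain_cons_cons] at h0
    obtain ⟨hac, X₁, hX₁, h3, h4, h5⟩ := exists_monoPath_gridEdge P Q hδ h0.1
    obtain ⟨hcb, X₂, hX₂, h6, h7, h8⟩ :=
      exists_monoPath_gridPath P Q hδ (c :: l) c ⟨h0.2, rfl, by simpa using h2⟩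
    obtain ⟨X, hX, h9, h10, h11⟩ := exists_monoPath_cons (elev P Q) (continuous_elev P Q) hX₁ hX₂
      (h4.trans h6.symm) hac hcb
    refine ⟨hac.trans hcb, X, hX, h9.trans h3, h10.trans h7, ?_⟩
    rw [h11]
    simp only [pathWeight]
    linarith

/-! ### Convergence -/

lemma exists_morphing_warpCost_le (P Q : PolyCurve d) {δ : ℝ}
    (hδ : ∀ i < P.n, ∀ j < Q.n, P.edgeLen i + Q.edgeLen j ≤ δ) {l : List (ℕ × ℕ)}
    (hl : IsPath (gridEdge P Q) (0, 0) (P.n, Q.n) l) :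
    ∃ m, IsMonotoneMorphing P Q m ∧
      warpCost P Q m ≤ pathWeight (gridWeight P Q) l + δ * (P.len + Q.len) := by
  obtain ⟨-, X, hX, h0, h1, h2⟩ := exists_monoPath_gridPath P Q hδ l _ hl
  simp only [brk_zero, add_zero, sub_zero] at h0 h1 h2
  refine ⟨_, isMonotoneMorphing_image_monoPath P Q hX h0 h1, ?_⟩
  rw [warpCost_image_monoPath P Q hX h0 h1]
  exact h2

lemma lowerBound_le_cdtw (P Q : PolyCurve d) : lowerBound P Q ≤ cdtw P Q := by
  obtain ⟨l, hl⟩ := exists_gridPath P Q le_rfl le_rfl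
  -- Only the existence of a morphing is needed here, to keep `cdtw` from being an infimum over the
  -- empty set; any `δ` will do.
  have hδ : ∀ i < P.n, ∀ j < Q.n, P.edgeLen i + Q.edgeLen j ≤ P.len + Q.len := fun i hi j hj => by
    have h1 := (split_iterate P 0).2.2 i hi
    have h2 := (split_iterate Q 0).2.2 j hj
    simp only [Function.iterate_zero, id, pow_zero, div_one] at h1 h2
    linarith
  obtain ⟨m, hm, -⟩ := exists_morphing_warpCost_le P Q hδ hl
  refine le_csInf ⟨_, m, hm, rfl⟩ ?_
  rintro _ ⟨m, hm, rfl⟩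
  exact lowerBound_le_warpCost hm

lemma cdtw_le_lowerBound_add (P Q : PolyCurve d) {δ : ℝ}
    (hδ : ∀ i < P.n, ∀ j < Q.n, P.edgeLen i + Q.edgeLen j ≤ δ) :
    cdtw P Q ≤ lowerBound P Q + δ * (P.len + Q.len) := by
  rw [← sub_le_iff_le_add]
  obtain ⟨l, hl⟩ := exists_gridPath P Q le_rfl le_rfl
  refine le_csInf ⟨_, l, hl, rfl⟩ ?_
  rintro _ ⟨l, hl, rfl⟩
  rw [sub_le_iff_le_add]
  obtain ⟨m, hm, hle⟩ := exists_morphing_warpCost_le P Q hδ hl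
  refine le_trans (csInf_le ?_ ⟨m, hm, rfl⟩) hle
  -- The costs are bounded below by `lowerBound` itself.
  refine ⟨lowerBound P Q, ?_⟩
  rintro _ ⟨m, hm, rfl⟩
  exact lowerBound_le_warpCost hm

/-- `cdtw` sees the vertices only through the length and the parameterization, which splitting
preserves. -/
lemma cdtw_congr {P P' Q Q' : PolyCurve d} (hP : P'.len = P.len) (hP' : P'.param = P.param)
    (hQ : Q'.len = Q.len) (hQ' : Q'.param = Q.param) : cdtw P' Q' = cdtw P Q := by
  simp only [cdtw, IsMonotoneMorphing, warpCost, elev, hP, hP', hQ, hQ']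

theorem tendsto_lowerBound_split (P Q : PolyCurve d) :
    Tendsto (fun i : ℕ => lowerBound (split^[i] P) (split^[i] Q)) atTop (𝓝 (cdtw P Q)) := by
  have heq : ∀ i, cdtw (split^[i] P) (split^[i] Q) = cdtw P Q := fun i =>
    cdtw_congr (split_iterate P i).1 (split_iterate P i).2.1 (split_iterate Q i).1
      (split_iterate Q i).2.1
  -- After `i` splittings `δ = (P.len + Q.len) / 2 ^ i` is admissible, which gives this error term.
  have hlim : Tendsto (fun i : ℕ => cdtw P Q - (P.len + Q.len) ^ 2 * (1 / 2 : ℝ) ^ i) atTop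
      (𝓝 (cdtw P Q)) := by
    have := tendsto_pow_atTop_nhds_zero_of_lt_one (r := (1 / 2 : ℝ)) (by norm_num) (by norm_num)
    simpa using (this.const_mul ((P.len + Q.len) ^ 2)).const_sub (cdtw P Q)
  refine tendsto_of_tendsto_of_tendsto_of_le_of_le hlim tendsto_const_nhds (fun i => ?_) fun i => ?_
  · have := cdtw_le_lowerBound_add (split^[i] P) (split^[i] Q)
      (δ := (P.len + Q.len) / 2 ^ i) fun k hk l hl => by
        rw [add_div]
        exact add_le_add ((split_iterate P i).2.2 k hk) ((split_iterate Q i).2.2 l hl)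
    rw [heq, (split_iterate P i).1, (split_iterate Q i).1] at this
    have h2 : (P.len + Q.len) / 2 ^ i * (P.len + Q.len) =
        (P.len + Q.len) ^ 2 * (1 / 2 : ℝ) ^ i := by
      rw [one_div, inv_pow]; ring
    simp only
    linarith
  · exact heq i ▸ lowerBound_le_cdtw _ _

end CurveSweep

theorem mainTheorem10 (d : ℕ) (P Q : CurveSweep.PolyCurve d) :
    (∀ w : ℝ, CurveSweep.IsSweepDistance P Q w → CurveSweep.lowerBound P Q ≤ w) ∧
      Tendsto
        (fun i : ℕ => CurveSweep.lowerBound (CurveSweep.PolyCurve.split^[i] P)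
          (CurveSweep.PolyCurve.split^[i] Q))
        atTop (𝓝 (CurveSweep.cdtw P Q)) :=
  ⟨fun _ h => CurveSweep.lowerBound_le_of_isSweepDistance h,
    CurveSweep.tendsto_lowerBound_split P Q⟩
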